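/- Let $A$ be a finite set of agents, each of whom owns one divisible unit of its own good, and let $u_{ij}\ge 0$ be the utility of agent $i\in A$ per unit of the good of agent $j\in A$. Let $E=\{ij : u_{ij}>0\}$; the digraph $(A,E)$ may have loops. A market equilibrium consists of prices $p_i>0$ $(i\in A)$ and allocations $x_{ij}\ge 0$ $(ij\in E)$, with $x_{ij}=0$ for $ij\notin E$, such that $\sum_i x_{ij}=1$ for every $j$; $\sum_j x_{ij}p_j=p_i$ for every $i$; and every agent gets an optimal bundle: $(x_{ij})_j$ maximizes $\sum_j u_{ij}b_j$ over all $b\ge 0$ with $\sum_j b_jp_j\le p_i$, and $x_{ij}>0$ implies $u_{ij}/p_j=\max_{k\in A}u_{ik}/p_k$. Consider the program in the variables $y=(y_{ij})_{ij\in E}$, $p=(p_i)_{i\in A}$, $\beta=(\beta_i)_{i\in A}$ $$\text{(CP)}\qquad \min\ \sum_{i\in A}p_i\log\frac{p_i}{\beta_i}-\sum_{ij\in E}y_{ij}\log u_{ij}$$ subject to $$\sum_{i:\,ij\in E}y_{ij}=p_j\ (j\in A),\quad \sum_{j:\,ij\in E}y_{ij}=p_i\ (i\in A),\quad u_{ij}\beta_i\le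 p_j\ (ij\in E),\quad p_i\ge 1\ (i\in A),\quad y,\beta\ge 0,$$ where $p_i\log(p_i/\beta_i)=+\infty$ if $\beta_i=0$. Then: 1. (CP) is a convex program: its feasible region is convex and its objective is convex there. 2. (CP) is feasible if and only if the following condition holds: $(\star)$ every strongly connected component of $(A,E)$ that consists of a single node has a loop at that node. 3. If $(\star)$ holds, then the minimum in (CP) is attained and equals $0$, and for every optimal solution $(y,p,\beta)$ the prices $p_i$ and the allocations $x_{ij}=y_{ij}/p_j$ form a market equilibrium. 4. Define the bitsize of a rational number with lowest-terms representation $a/b$ as $\lceil\log_2|a|\rceil+\lceil\log_2 b\rceil$ (and as $0$ for the number $0$), and the input size of a market with rational utilities as $|A|+|E|$ plus the sum of the bitsizes of all $u_{ij}$, $ij\in E$. There is a polynomial $P$ such that for every market with rational utilities that satisfies $(\star)$ there is a rational optimal solution $(y,p,\beta)$ of (CP) that is an extreme point of the feasible region, such that $p$ and $x_{ij}=y_{ij}/p_j$ form a market equilibrium in rational numbers, and the total bitsize of all $p_i$ and $x_{ij}$ is at most $P$ of the input size. -/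

import Mathlib

namespace ArrowDebreu

/-- `ij` is an arc of the market digraph: agent `i` has positive utility for the good of `j`. -/
def Arc {A : Type*} (u : A → A → ℝ) (i j : A) : Prop := 0 < u i j

noncomputable instance {A : Type*} (u : A → A → ℝ) (i j : A) : Decidable (Arc u i j) :=
  Classical.propDecidable _

/-- The strongly connected component of the node `i` in the market digraph: the nodes that can be
reached from `i` and from which `i` can be reached. -/
def scc {A : Type*} (u : A → A → ℝ) (i : A) : Set A :=
  {j | Relation.ReflTransGen (Arc u) i j ∧ Relation.ReflTransGen (Arc u) j i}

/-- Condition (⋆): every one-element strongly connected component carries a loop. -/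
def SingletonComponentsHaveLoops {A : Type*} (u : A → A → ℝ) : Prop :=
  ∀ i : A, (scc u i).ncard = 1 → ∃ k ∈ scc u i, Arc u k k

/-- Market equilibrium with prices `p` and allocation `x`, in the market where every agent owns one
unit of its own good. The allocation lives on the arcs, i.e. it is extended by `0` to all pairs. -/
structure IsEquilibrium {A : Type*} [Fintype A] (u : A → A → ℝ) (p : A → ℝ) (x : A → A → ℝ) :
    Prop where
  price_pos : ∀ i, 0 < p i
  alloc_nonneg : ∀ i j, 0 ≤ x i j
  alloc_arc : ∀ i j, ¬ Arc u i j → x i j = 0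
  /-- every good is fully sold -/
  sold : ∀ j, ∑ i, x i j = 1
  /-- every agent spends exactly its income -/
  budget : ∀ i, ∑ j, x i j * p j = p i
  /-- every agent gets a utility maximizing bundle among those it can afford -/
  optimal_bundle : ∀ i, ∀ b : A → ℝ, (∀ j, 0 ≤ b j) → ∑ j, b j * p j ≤ p i →
    ∑ j, u i j * b j ≤ ∑ j, u i j * x i j
  /-- only goods of maximal bang-per-buck are bought -/
  best_buy : ∀ i j, 0 < x i j → ∀ k, u i k / p k ≤ u i j / p j

/-- The variables `(y, p, β)` of the convex program. -/
abbrev Vars (A : Type*) : Type _ := (A → A → ℝ) × (A → ℝ) × (A → ℝ)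

/-- The payments `y i j`. -/
abbrev Vars.pay {A : Type*} (z : Vars A) : A → A → ℝ := z.1

/-- The prices `p i`. -/
abbrev Vars.price {A : Type*} (z : Vars A) : A → ℝ := z.2.1

/-- The inverse best bang-per-buck values `β i`. -/
abbrev Vars.invBpb {A : Type*} (z : Vars A) : A → ℝ := z.2.2

/-- The constraints of the convex program. The payments are indexed by the arcs, i.e. they are
extended by `0` to all pairs. -/
structure IsFeasible {A : Type*} [Fintype A] (u : A → A → ℝ) (z : Vars A) : Prop where
  inflow : ∀ j, ∑ i with Arc u i j, z.pay i j = z.price j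
  outflow : ∀ i, ∑ j with Arc u i j, z.pay i j = z.price i
  bpb : ∀ i j, Arc u i j → u i j * z.invBpb i ≤ z.price j
  one_le_price : ∀ i, 1 ≤ z.price i
  pay_nonneg : ∀ i j, Arc u i j → 0 ≤ z.pay i j
  invBpb_nonneg : ∀ i, 0 ≤ z.invBpb i
  pay_arc : ∀ i j, ¬ Arc u i j → z.pay i j = 0

/-- The feasible polyhedron. -/
def feasibleSet {A : Type*} [Fintype A] (u : A → A → ℝ) : Set (Vars A) := {z | IsFeasible u z}

/-- The relative entropy term `p log (p / b)` for `p, b ≥ 0`, equal to `+∞` for `b = 0 < p` and to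
`0` for `p = 0`. -/
noncomputable def relEntropy (p b : ℝ) : EReal :=
  open Classical in if b = 0 ∧ p ≠ 0 then ⊤ else ((p * Real.log (p / b) : ℝ) : EReal)

/-- The objective function `∑ p_i log (p_i / β_i) - ∑_{ij ∈ E} y_ij log u_ij`. -/
noncomputable def objective {A : Type*} [Fintype A] (u : A → A → ℝ) (z : Vars A) : EReal :=
  ∑ i, relEntropy (z.price i) (z.invBpb i) -
    ((∑ i, ∑ j with Arc u i j, z.pay i j * Real.log (u i j) : ℝ) : EReal)

/-- The program is convex: its feasible region is convex and the (extended real valued) objective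
is convex there. -/
def IsConvexProgram {A : Type*} [Fintype A] (u : A → A → ℝ) : Prop :=
  Convex ℝ (feasibleSet u) ∧
    ∀ z ∈ feasibleSet u, ∀ w ∈ feasibleSet u, ∀ a b : ℝ, 0 ≤ a → 0 ≤ b → a + b = 1 →
      objective u (a • z + b • w) ≤ (a : EReal) * objective u z + (b : EReal) * objective u w

/-- Optimal solutions of the convex program. -/
def IsOptimal {A : Type*} [Fintype A] (u : A → A → ℝ) (z : Vars A) : Prop :=
  z ∈ feasibleSet u ∧ ∀ w ∈ feasibleSet u, objective u z ≤ objective u w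

/-- The bitsize `⌈log₂ |a|⌉ + ⌈log₂ b⌉` of a fraction `a / b` in lowest terms (`0` for `0`). -/
def bitsize (q : ℚ) : ℕ := Nat.clog 2 q.num.natAbs + Nat.clog 2 q.den

/-- The size of a rational instance: number of agents, number of arcs, and the bitsizes of the
utilities on the arcs. -/
def inputSize {A : Type*} [Fintype A] (u : A → A → ℚ) : ℕ :=
  Fintype.card A + ∑ i, ∑ j with 0 < u i j, (1 + bitsize (u i j))

/-- The total bitsize of rational prices and allocations. -/
def outputSize {A : Type*} [Fintype A] (p : A → ℚ) (x : A → A → ℚ) : ℕ :=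
  ∑ i, bitsize (p i) + ∑ i, ∑ j, bitsize (x i j)

end ArrowDebreu

/-!
By flow conservation the objective is the sum over `ij` of `y i j * log (p j / (u i j * β i))`, and
by the bang-per-buck constraints these terms are nonnegative. So the objective is at least `0`, and
a feasible point of value `0` is one where money is only spent on goods of maximal bang-per-buck,
that is, an equilibrium.

That the value `0` is attained is a duality argument. If every arc lies inside a strongly connected
component, then scaling each component to minimal price `1` moves every sublevel set into a compact
set, so a minimum exists; its Karush–Kuhn–Tucker multipliers, combined with `log x ≤ x - 1`, show
that it is `0`. In general, one solves the program for the arcs inside the components and scales the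
solutions so that goods of later components are too expensive for the agents of earlier ones.
Feasibility is the existence of a circulation that is positive at every node, and this is (⋆).

Optimality survives the move from an optimal point to a vertex, because no tight constraint is lost.
With rational utilities the vertex solves an integral linear system, and Cramer's rule bounds its
bitsize.
-/

namespace ArrowDebreu

section Polyhedra

variable {V R : Type*} [AddCommGroup V] [Module ℝ V]

theorem mem_hull_insert_of_comp_projection {S : Set (Module.Dual ℝ V)} {f g : Module.Dual ℝ V}
    {d₀ : V} (hS : ∀ h ∈ S, 0 ≤ h d₀) (hf₀ : f d₀ ≤ 0)
    (hf : f ∘ₗ (LinearMap.id + g.smulRight d₀) ∈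
      PointedCone.hull ℝ ((· ∘ₗ (LinearMap.id + g.smulRight d₀)) '' S)) :
    f ∈ PointedCone.hull ℝ (insert g S) := by
  set π : V →ₗ[ℝ] V := LinearMap.id + g.smulRight d₀ with hπ
  obtain ⟨h, hh, hhπ⟩ : f ∘ₗ π ∈ PointedCone.map π.dualMap (PointedCone.hull ℝ S) := by
    rw [PointedCone.map, Submodule.map_span]
    exact hf
  have hhd₀ : 0 ≤ h d₀ := Submodule.span_induction (fun k hk => hS k hk) le_rfl
    (fun _ _ _ _ => add_nonneg) (fun a _ _ => mul_nonneg a.2) hh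
  have hfh : f = h + (⟨h d₀ - f d₀, by linarith⟩ : {a : ℝ // 0 ≤ a}) • g := by
    ext d
    have hd : h d + g d * h d₀ = f d + g d * f d₀ := by
      simpa [hπ] using LinearMap.congr_fun hhπ d
    change f d = h d + (h d₀ - f d₀) * g d
    linarith
  rw [hfh]
  exact add_mem (Submodule.span_mono (Set.subset_insert _ _) hh)
    (Submodule.smul_mem _ _ (Submodule.subset_span (Set.mem_insert _ _)))

/-- **Farkas' lemma**: a linear functional that is nonnegative wherever finitely many others are is
a conic combination of them. -/
theorem mem_hull_of_forall_nonneg (φ : R → V →ₗ[ℝ] ℝ) (s : Finset R) (f : V →ₗ[ℝ] ℝ)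
    (hf : ∀ d, (∀ r ∈ s, 0 ≤ φ r d) → 0 ≤ f d) :
    f ∈ PointedCone.hull ℝ (φ '' s) := by
  classical
  induction s using Finset.induction_on generalizing φ f with
  | empty =>
    have hf0 : f = 0 := by
      ext d
      have hneg := hf (-d) (by simp)
      rw [map_neg] at hneg
      exact le_antisymm (neg_nonneg.1 hneg) (hf d (by simp))
    exact hf0 ▸ zero_mem _
  | insert r₀ s _ ih =>
    by_cases hs : ∀ d, (∀ r ∈ s, 0 ≤ φ r d) → 0 ≤ f d
    · exact Submodule.span_mono (Set.image_mono (by simp)) (ih φ f hs)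
    push Not at hs
    obtain ⟨d₁, hd₁, hfd₁⟩ := hs
    have hneg : φ r₀ d₁ < 0 := by
      by_contra! h
      exact hfd₁.not_ge (hf d₁ (by simpa [h] using hd₁))
    obtain ⟨d₀, hd₀, hr₀, hfd₀⟩ : ∃ d₀, (∀ r ∈ s, 0 ≤ φ r d₀) ∧ φ r₀ d₀ = -1 ∧ f d₀ ≤ 0 := by
      have hpos : 0 < (-φ r₀ d₁)⁻¹ := inv_pos.2 (neg_pos.2 hneg)
      refine ⟨(-φ r₀ d₁)⁻¹ • d₁, fun r hr => ?_, ?_, ?_⟩ <;> rw [map_smul, smul_eq_mul]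
      · exact mul_nonneg hpos.le (hd₁ r hr)
      · rw [inv_neg, neg_mul, inv_mul_cancel₀ hneg.ne]
      · exact mul_nonpos_of_nonneg_of_nonpos hpos.le hfd₁.le
    rw [Finset.coe_insert, Set.image_insert_eq]
    refine mem_hull_insert_of_comp_projection (d₀ := d₀) (by simpa using hd₀) hfd₀ ?_
    rw [← Set.image_comp]
    refine ih (fun r => φ r ∘ₗ (LinearMap.id + (φ r₀).smulRight d₀)) _ fun d hd => ?_
    refine hf _ fun r hr => ?_
    rcases Finset.mem_insert.1 hr with rfl | hr
    · simp [hr₀]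
    · exact hd r hr

/-- Farkas' lemma for a cone cut out by inequalities and equations. -/
theorem exists_multipliers_of_forall_nonneg [Fintype R] (φ : R → V →ₗ[ℝ] ℝ) {T E : Set R}
    (hET : E ⊆ T) {f : V →ₗ[ℝ] ℝ}
    (hf : ∀ d, (∀ r ∈ T, 0 ≤ φ r d) → (∀ r ∈ E, φ r d = 0) → 0 ≤ f d) :
    ∃ l : R → ℝ, (∀ r ∉ E, 0 ≤ l r) ∧ (∀ r ∉ T, l r = 0) ∧ ∀ d, f d = ∑ r, l r * φ r d := by
  classical
  have hhull : f ∈ PointedCone.hull ℝ (φ '' T ∪ (-φ) '' E) := by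
    have h := mem_hull_of_forall_nonneg (Sum.elim φ (-φ))
      {x | Sum.elim (· ∈ T) (· ∈ E) x} f fun d hd => hf d
        (fun r hr => hd (.inl r) (by simpa)) fun r hr => le_antisymm
          (by simpa using hd (.inr r) (by simpa)) (hd (.inl r) (by simpa using hET hr))
    refine Submodule.span_mono ?_ h
    rintro _ ⟨r | r, hr, rfl⟩
    exacts [.inl ⟨r, by simpa using hr, rfl⟩, .inr ⟨r, by simpa using hr, rfl⟩]
  rw [PointedCone.hull, Submodule.span_union, Submodule.mem_sup] at hhull
  obtain ⟨_, hg, _, hh, rfl⟩ := hhull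
  obtain ⟨a, ha, rfl⟩ := (Finsupp.mem_span_image_iff_linearCombination _).1 hg
  obtain ⟨b, hb, rfl⟩ := (Finsupp.mem_span_image_iff_linearCombination _).1 hh
  have hbE : ∀ r ∉ E, b r = 0 := fun r hr => Finsupp.notMem_support_iff.1 fun h => hr (hb h)
  have haT : ∀ r ∉ T, a r = 0 := fun r hr => Finsupp.notMem_support_iff.1 fun h => hr (ha h)
  refine ⟨fun r => a r - b r, fun r hr => ?_, fun r hr => ?_, fun d => ?_⟩
  · simpa [hbE r hr] using (a r).2
  · simp [hbE r fun h => hr (hET h), haT r hr]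
  · have heval (ψ : R → V →ₗ[ℝ] ℝ) (m : R →₀ {a : ℝ // 0 ≤ a}) :
        Finsupp.linearCombination _ ψ m d = ∑ r, (m r : ℝ) * ψ r d := by
      rw [Finsupp.linearCombination_apply, Finsupp.sum_fintype _ _ (by simp), LinearMap.sum_apply]
      rfl
    rw [LinearMap.add_apply, heval, heval, ← Finset.sum_add_distrib]
    exact Finset.sum_congr rfl fun r _ => by rw [Pi.neg_apply, LinearMap.neg_apply]; ring

/-- The polyhedron of the points `x` with `c r ≤ φ r x` for all rows `r`, where the rows in `E` are
required to hold with equality. -/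
def polyhedron (φ : R → V →ₗ[ℝ] ℝ) (c : R → ℝ) (E : Set R) : Set V :=
  {x | (∀ r, c r ≤ φ r x) ∧ ∀ r ∈ E, φ r x = c r}

variable {φ : R → V →ₗ[ℝ] ℝ} {c : R → ℝ} {E : Set R}

theorem convex_polyhedron : Convex ℝ (polyhedron φ c E) := by
  rintro x ⟨hx, hxE⟩ y ⟨hy, hyE⟩ a b ha hb hab
  have hc (r : R) : c r = a * c r + b * c r := by rw [← add_mul, hab, one_mul]
  refine ⟨fun r => ?_, fun r hr => ?_⟩ <;> rw [map_add, map_smul, map_smul, hc r]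
  · exact add_le_add (mul_le_mul_of_nonneg_left (hx r) ha) (mul_le_mul_of_nonneg_left (hy r) hb)
  · rw [hxE r hr, hyE r hr, smul_eq_mul, smul_eq_mul]

theorem eventually_add_smul_mem_polyhedron [Finite R] {x d : V} (hx : x ∈ polyhedron φ c E)
    (hd : ∀ r, φ r x = c r → 0 ≤ φ r d) (hdE : ∀ r ∈ E, φ r d = 0) :
    ∀ᶠ t : ℝ in nhdsWithin 0 (Set.Ioi 0), x + t • d ∈ polyhedron φ c E := by
  have hineq : ∀ᶠ t : ℝ in nhdsWithin 0 (Set.Ioi 0), ∀ r, c r ≤ φ r x + t * φ r d := by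
    refine Filter.eventually_all.2 fun r => ?_
    rcases (hx.1 r).eq_or_lt' with htight | hslack
    · filter_upwards [self_mem_nhdsWithin] with t ht
      exact htight ▸ le_add_of_nonneg_right (mul_nonneg (le_of_lt ht) (hd r htight))
    · have hcont : Continuous fun t : ℝ => φ r x + t * φ r d := by fun_prop
      have h := hcont.continuousAt.eventually (lt_mem_nhds (a := c r) (b := φ r x + 0 * φ r d)
        (by simpa using hslack))
      exact (h.filter_mono nhdsWithin_le_nhds).mono fun t => le_of_lt
  filter_upwards [hineq] with t ht
  exact ⟨by simpa using ht, fun r hr => by simp [hx.2 r hr, hdE r hr]⟩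

theorem mem_extremePoints_polyhedron {x : V} (hx : x ∈ polyhedron φ c E)
    (hker : ∀ d, (∀ r, φ r x = c r → φ r d = 0) → d = 0) :
    x ∈ (polyhedron φ c E).extremePoints ℝ := by
  refine mem_extremePoints_iff_left.2 ⟨hx, ?_⟩
  rintro y hy z hz ⟨a, b, ha, hb, hab, rfl⟩
  refine sub_eq_zero.1 (hker _ fun r hr => ?_)
  rw [map_sub, hr, sub_eq_zero]
  rw [map_add, map_smul, map_smul, smul_eq_mul, smul_eq_mul] at hr
  have hy' := mul_le_mul_of_nonneg_left (hy.1 r) ha.le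
  have hz' := mul_le_mul_of_nonneg_left (hz.1 r) hb.le
  have hc : a * c r + b * c r = c r := by rw [← add_mul, hab, one_mul]
  exact mul_left_cancel₀ ha.ne' (by linarith)

/-- If the tight rows are constant along `d` and some row decreases, walk along `d` up to the first
row that becomes tight. -/
theorem exists_mem_polyhedron_new_tight [Finite R] {x d : V} (hx : x ∈ polyhedron φ c E)
    (hd : ∀ r, φ r x = c r → φ r d = 0) {r₁ : R} (hr₁ : φ r₁ d < 0) :
    ∃ y ∈ polyhedron φ c E, (∀ r, φ r x = c r → φ r y = c r) ∧
      ∃ r, φ r y = c r ∧ φ r x ≠ c r := by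
  have : Nonempty {r // φ r d < 0} := ⟨⟨r₁, hr₁⟩⟩
  obtain ⟨⟨r₂, hr₂⟩, hmin⟩ :=
    Finite.exists_min fun r : {r // φ r d < 0} => (φ r x - c r) / -φ r d
  set t : ℝ := (φ r₂ x - c r₂) / -φ r₂ d
  have ht0 : 0 ≤ t := div_nonneg (sub_nonneg.2 (hx.1 r₂)) (neg_nonneg.2 hr₂.le)
  have hmove (r : R) : φ r (x + t • d) = φ r x + t * φ r d := by simp
  have htight (r : R) (hr : φ r x = c r) : φ r (x + t • d) = c r := by
    rw [hmove, hd r hr, hr, mul_zero, add_zero]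
  refine ⟨x + t • d, ⟨fun r => ?_, fun r hr => htight r (hx.2 r hr)⟩, htight, r₂, ?_,
    fun h => hr₂.ne (hd r₂ h)⟩
  · rw [hmove]
    rcases lt_or_ge (φ r d) 0 with h | h
    · have hle : t ≤ _ := hmin ⟨r, h⟩
      rw [le_div_iff₀ (neg_pos.2 h)] at hle
      linarith
    · exact (hx.1 r).trans (le_add_of_nonneg_right (mul_nonneg ht0 h))
  · have hmul : t * -φ r₂ d = φ r₂ x - c r₂ := div_mul_cancel₀ _ (neg_ne_zero.2 hr₂.ne)
    rw [hmove]
    linarith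

/-- In a polyhedron without lines, every point can be moved to a vertex without leaving the face of
its tight rows. -/
theorem exists_vertex_of_mem_polyhedron [Finite R] (hφ : ∀ d, (∀ r, φ r d = 0) → d = 0) {x : V}
    (hx : x ∈ polyhedron φ c E) :
    ∃ y ∈ polyhedron φ c E, (∀ r, φ r x = c r → φ r y = c r) ∧
      ∀ d, (∀ r, φ r y = c r → φ r d = 0) → d = 0 := by
  induction hn : {r | φ r x ≠ c r}.ncard using Nat.strong_induction_on generalizing x with
  | _ n ih =>
    by_cases hker : ∀ d, (∀ r, φ r x = c r → φ r d = 0) → d = 0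
    · exact ⟨x, hx, fun _ => id, hker⟩
    push Not at hker
    obtain ⟨d, hd, hd0⟩ := hker
    obtain ⟨r₁, hr₁⟩ : ∃ r, φ r d ≠ 0 := by
      by_contra! h
      exact hd0 (hφ d h)
    obtain ⟨e, he, hre⟩ : ∃ e, (∀ r, φ r x = c r → φ r e = 0) ∧ φ r₁ e < 0 := by
      rcases lt_or_gt_of_ne hr₁ with h | h
      · exact ⟨d, hd, h⟩
      · exact ⟨-d, fun r hr => by simp [hd r hr], by simpa using h⟩
    obtain ⟨y, hy, hxy, r, hry, hrx⟩ := exists_mem_polyhedron_new_tight hx he hre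
    have hsub : {r | φ r y ≠ c r} ⊆ {r | φ r x ≠ c r} := fun r hr h => hr (hxy r h)
    have hlt : {r | φ r y ≠ c r}.ncard < n := hn ▸ Set.ncard_lt_ncard
      ((Set.ssubset_iff_of_subset hsub).2 ⟨r, hrx, fun h => h hry⟩)
    obtain ⟨z, hz, hyz, hkz⟩ := ih _ hlt hy rfl
    exact ⟨z, hz, fun r hr => hyz r (hxy r hr), hkz⟩

end Polyhedra

section KarushKuhnTucker

variable {V R : Type*} [NormedAddCommGroup V] [NormedSpace ℝ V] {φ : R → V →ₗ[ℝ] ℝ} {c : R → ℝ}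
  {E : Set R}

theorem isClosed_polyhedron [FiniteDimensional ℝ V] : IsClosed (polyhedron φ c E) := by
  have hcont (r : R) : Continuous (φ r) := (φ r).continuous_of_finiteDimensional
  simp only [polyhedron, Set.ofPred_and, Set.ofPred_forall]
  exact (isClosed_iInter fun r => isClosed_le continuous_const (hcont r)).inter
    (isClosed_biInter fun r _ => isClosed_eq (hcont r) continuous_const)

/-- The Karush–Kuhn–Tucker conditions; no constraint qualification is needed on a polyhedron. -/
theorem exists_multipliers_of_isLocalMinOn [Fintype R] {f : V → ℝ} {f' : V →L[ℝ] ℝ} {x : V}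
    (hmin : IsLocalMinOn f (polyhedron φ c E) x) (hf : HasFDerivAt f f' x)
    (hx : x ∈ polyhedron φ c E) :
    ∃ l : R → ℝ, (∀ r ∉ E, 0 ≤ l r) ∧ (∀ r, l r * φ r x = l r * c r) ∧
      ∀ d, f' d = ∑ r, l r * φ r d := by
  obtain ⟨l, hl, hslack, hfl⟩ := exists_multipliers_of_forall_nonneg φ
    (T := {r | φ r x = c r}) (fun r hr => hx.2 r hr) (f := f'.toLinearMap) fun d hd hdE =>
      hmin.hasFDerivWithinAt_nonneg hf.hasFDerivWithinAt (mem_posTangentConeAt_of_frequently_mem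
        (eventually_add_smul_mem_polyhedron hx hd hdE).frequently)
  refine ⟨l, hl, fun r => ?_, hfl⟩
  by_cases hr : φ r x = c r
  · rw [hr]
  · rw [hslack r hr, zero_mul, zero_mul]

end KarushKuhnTucker

section Cramer

open scoped Nat Matrix

variable {R ι : Type*} [Fintype R] [Fintype ι]

theorem abs_dotProduct_le {f g : R → ℤ} {B : ℕ} (hf : ∀ r, |f r| ≤ B) (hg : ∀ r, |g r| ≤ B) :
    |f ⬝ᵥ g| ≤ (Fintype.card R * B ^ 2 : ℕ) :=
  calc |∑ r, f r * g r| ≤ ∑ r, |f r| * |g r| := by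
        simpa only [abs_mul] using Finset.abs_sum_le_sum_abs (fun r => f r * g r) _
    _ ≤ ∑ _r : R, (B : ℤ) * B := Finset.sum_le_sum fun r _ =>
        mul_le_mul (hf r) (hg r) (abs_nonneg _) (Int.natCast_nonneg B)
    _ = (Fintype.card R * B ^ 2 : ℕ) := by simp [sq]

theorem natAbs_det_le [DecidableEq ι] {M : Matrix ι ι ℤ} {B : ℕ} (hM : ∀ i j, |M i j| ≤ B) :
    M.det.natAbs ≤ (Fintype.card ι)! * B ^ Fintype.card ι := by
  have h := Matrix.det_le (abv := AbsoluteValue.abs) hM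
  rw [AbsoluteValue.abs_apply, nsmul_eq_mul, Int.abs_eq_natAbs] at h
  exact_mod_cast h

theorem det_transpose_mul_self_ne_zero [DecidableEq ι] {K : Type*} [Field K] [LinearOrder K]
    [IsStrictOrderedRing K] {M : Matrix R ι K} (hM : ∀ d, M *ᵥ d = 0 → d = 0) :
    (Mᵀ * M).det ≠ 0 := by
  intro h
  obtain ⟨d, hd0, hd⟩ := Matrix.exists_mulVec_eq_zero_iff.2 h
  refine hd0 (hM d (dotProduct_self_eq_zero.1 ?_))
  rw [Matrix.dotProduct_mulVec, Matrix.vecMul_mulVec, ← Matrix.mulVec_transpose,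
    Matrix.transpose_mul, Matrix.transpose_transpose, hd, zero_dotProduct]

/-- Cramer's rule for the normal equations `Mᵀ M x = Mᵀ c`: the unique solution of an integral
linear system is a vector of fractions with a common denominator of bounded size. -/
theorem exists_int_fractions_of_unique_solution {M : Matrix R ι ℤ} {c : R → ℤ} {B : ℕ}
    (hM : ∀ r k, |M r k| ≤ B) (hc : ∀ r, |c r| ≤ B) {x : ι → ℝ}
    (hx : M.map (Int.castRingHom ℝ) *ᵥ x = Int.castRingHom ℝ ∘ c)
    (hker : ∀ d : ι → ℝ, M.map (Int.castRingHom ℝ) *ᵥ d = 0 → d = 0) :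
    ∃ (D : ℤ) (N : ι → ℤ), D ≠ 0 ∧ (∀ k, x k = N k / D) ∧
      D.natAbs ≤ (Fintype.card ι)! * (Fintype.card R * B ^ 2) ^ Fintype.card ι ∧
      ∀ k, (N k).natAbs ≤ (Fintype.card ι)! * (Fintype.card R * B ^ 2) ^ Fintype.card ι := by
  classical
  set MR : Matrix R ι ℝ := M.map (Int.castRingHom ℝ) with hMR
  have hG : (Mᵀ * M).map (Int.castRingHom ℝ) = MRᵀ * MR := by
    rw [Matrix.map_mul, Matrix.transpose_map]
  have hdet : (((Mᵀ * M).det : ℤ) : ℝ) = (MRᵀ * MR).det :=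
    ((Int.castRingHom ℝ).map_det _).trans (congrArg Matrix.det hG)
  have hdet0 : (((Mᵀ * M).det : ℤ) : ℝ) ≠ 0 := hdet ▸ det_transpose_mul_self_ne_zero hker
  have hcramer (k : ι) :
      (((Mᵀ * M).cramer (Mᵀ *ᵥ c) k : ℤ) : ℝ) = ((Mᵀ * M).det : ℤ) * x k := by
    have hadj : (Mᵀ * M).adjugate.map (Int.castRingHom ℝ) = (MRᵀ * MR).adjugate :=
      ((Int.castRingHom ℝ).map_adjugate _).trans (congrArg Matrix.adjugate hG)
    have hv : Int.castRingHom ℝ ∘ (Mᵀ *ᵥ c) = (MRᵀ * MR) *ᵥ x := by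
      rw [← Matrix.mulVec_mulVec, hx, hMR, ← Matrix.transpose_map]
      exact funext ((Int.castRingHom ℝ).map_mulVec _ _)
    calc (((Mᵀ * M).cramer (Mᵀ *ᵥ c) k : ℤ) : ℝ)
        = ((MRᵀ * MR).adjugate *ᵥ ((MRᵀ * MR) *ᵥ x)) k := by
          rw [Matrix.cramer_eq_adjugate_mulVec, ← hadj, ← hv]
          exact (Int.castRingHom ℝ).map_mulVec _ _ _
      _ = ((Mᵀ * M).det : ℤ) * x k := by
          rw [Matrix.mulVec_mulVec, Matrix.adjugate_mul, Matrix.smul_mulVec, Matrix.one_mulVec,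
            hdet, Pi.smul_apply, smul_eq_mul]
  have hGle (i j : ι) : |(Mᵀ * M) i j| ≤ (Fintype.card R * B ^ 2 : ℕ) :=
    abs_dotProduct_le (fun r => hM r i) fun r => hM r j
  refine ⟨(Mᵀ * M).det, (Mᵀ * M).cramer (Mᵀ *ᵥ c), fun h => hdet0 (by rw [h, Int.cast_zero]),
    fun k => by rw [hcramer, mul_div_cancel_left₀ _ hdet0], natAbs_det_le hGle, fun k => ?_⟩
  rw [Matrix.cramer_apply]
  refine natAbs_det_le fun i j => ?_
  rw [Matrix.updateCol_apply]
  split_ifs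
  exacts [abs_dotProduct_le (fun r => hM r i) hc, hGle i j]

end Cramer

section ConstraintSystem

/-- The coordinates of a point `(y, p, β)` of the convex program. -/
inductive Coord (A : Type*)
  | pay (i j : A)
  | price (i : A)
  | invBpb (i : A)

/-- The rows of the linear constraint system of the convex program: a sign or lower bound constraint
for every coordinate, flow conservation, and the bang-per-buck inequalities. Rows of pairs that are
not arcs are included; `eqRows` and the choice of coefficients make them harmless. -/
inductive Row (A : Type*)
  | coord (k : Coord A)
  | inflow (j : A)
  | outflow (i : A)
  | bpb (i j : A)

variable {A : Type*}

/-- Coordinates as a sum type, to count them and to sum over them. -/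
def coordEquiv : (A × A) ⊕ A ⊕ A ≃ Coord A where
  toFun := Sum.elim (fun x => .pay x.1 x.2) (Sum.elim .price .invBpb)
  invFun
    | .pay i j => .inl (i, j)
    | .price i => .inr (.inl i)
    | .invBpb i => .inr (.inr i)
  left_inv := by rintro (⟨i, j⟩ | i | i) <;> rfl
  right_inv := by rintro (⟨i, j⟩ | i | i) <;> rfl

/-- Rows as a sum type, to count them and to sum over them. -/
def rowEquiv : Coord A ⊕ A ⊕ A ⊕ A × A ≃ Row A where
  toFun := Sum.elim .coord (Sum.elim .inflow (Sum.elim .outflow fun x => .bpb x.1 x.2))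
  invFun
    | .coord k => .inl k
    | .inflow j => .inr (.inl j)
    | .outflow i => .inr (.inr (.inl i))
    | .bpb i j => .inr (.inr (.inr (i, j)))
  left_inv := by rintro (k | j | i | ⟨i, j⟩) <;> rfl
  right_inv := by rintro (k | j | i | ⟨i, j⟩) <;> rfl

instance [Fintype A] : Fintype (Coord A) := Fintype.ofEquiv _ coordEquiv

instance [Fintype A] : Fintype (Row A) := Fintype.ofEquiv _ rowEquiv

theorem sum_coord [Fintype A] {M : Type*} [AddCommMonoid M] (f : Coord A → M) :
    ∑ k, f k = ∑ i, ∑ j, f (.pay i j) + (∑ i, f (.price i) + ∑ i, f (.invBpb i)) := by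
  rw [← coordEquiv.sum_comp, Fintype.sum_sum_type, Fintype.sum_sum_type, Fintype.sum_prod_type]
  rfl

theorem sum_row [Fintype A] {M : Type*} [AddCommMonoid M] (f : Row A → M) :
    ∑ r, f r = ∑ k, f (.coord k) +
      (∑ j, f (.inflow j) + (∑ i, f (.outflow i) + ∑ i, ∑ j, f (.bpb i j))) := by
  rw [← rowEquiv.sum_comp, Fintype.sum_sum_type, Fintype.sum_sum_type, Fintype.sum_sum_type,
    Fintype.sum_prod_type]
  rfl

theorem card_coord [Fintype A] :
    Fintype.card (Coord A) = Fintype.card A ^ 2 + 2 * Fintype.card A := by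
  rw [← Fintype.card_congr coordEquiv, Fintype.card_sum, Fintype.card_sum, Fintype.card_prod]
  ring

theorem card_row [Fintype A] :
    Fintype.card (Row A) = 2 * Fintype.card A ^ 2 + 4 * Fintype.card A := by
  rw [← Fintype.card_congr rowEquiv, Fintype.card_sum, Fintype.card_sum, Fintype.card_sum,
    Fintype.card_prod, card_coord]
  ring

/-- The variables of the convex program as a vector of coordinates. -/
def coords : Vars A ≃ₗ[ℝ] (Coord A → ℝ) where
  toFun z
    | .pay i j => z.pay i j
    | .price i => z.price i
    | .invBpb i => z.invBpb i
  invFun x := (fun i j => x (.pay i j), fun i => x (.price i), fun i => x (.invBpb i))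
  map_add' z w := by ext (_ | _ | _) <;> rfl
  map_smul' a z := by ext (_ | _ | _) <;> rfl
  left_inv z := rfl
  right_inv x := by ext (_ | _ | _) <;> rfl

/-- The linear forms of the constraint system. The bang-per-buck row of `ij` is
`s i j * p j - t i j * β i`; it represents `u i j * β i ≤ p j` whenever `t = s * u`, which allows
clearing denominators. -/
def row {K : Type*} [CommRing K] [Fintype A] (s t : A → A → K) : Row A → (Coord A → K) →ₗ[K] K
  | .coord k => LinearMap.proj k
  | .inflow j => ∑ i, LinearMap.proj (.pay i j) - LinearMap.proj (.price j)
  | .outflow i => ∑ j, LinearMap.proj (.pay i j) - LinearMap.proj (.price i)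
  | .bpb i j => s i j • LinearMap.proj (.price j) - t i j • LinearMap.proj (.invBpb i)

/-- The right-hand sides of the constraint system. -/
def rowBound (K : Type*) [CommRing K] : Row A → K
  | .coord (.price _) => 1
  | _ => 0

/-- The rows that hold with equality: flow conservation, and vanishing payments off the arcs. -/
def eqRows (u : A → A → ℝ) : Set (Row A) :=
  {r | match r with
    | .inflow _ | .outflow _ => True
    | .coord (.pay i j) => ¬Arc u i j
    | _ => False}

variable [Fintype A] {u s t : A → A → ℝ} {z : Vars A}

namespace IsFeasible

theorem sum_inflow (h : IsFeasible u z) (j : A) : ∑ i, z.pay i j = z.price j := by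
  rw [← h.inflow j, Finset.sum_filter_of_ne fun i _ => not_imp_comm.1 (h.pay_arc i j)]

theorem sum_outflow (h : IsFeasible u z) (i : A) : ∑ j, z.pay i j = z.price i := by
  rw [← h.outflow i, Finset.sum_filter_of_ne fun j _ => not_imp_comm.1 (h.pay_arc i j)]

theorem zero_le_pay (h : IsFeasible u z) (i j : A) : 0 ≤ z.pay i j := by
  by_cases hij : Arc u i j
  exacts [h.pay_nonneg i j hij, (h.pay_arc i j hij).ge]

theorem price_pos (h : IsFeasible u z) (i : A) : 0 < z.price i :=
  one_pos.trans_le (h.one_le_price i)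

theorem arc_of_pay_ne_zero (h : IsFeasible u z) {i j : A} (hij : z.pay i j ≠ 0) : Arc u i j :=
  not_not.1 fun hn => hij (h.pay_arc i j hn)

theorem mul_invBpb_le_price (h : IsFeasible u z) (i j : A) : u i j * z.invBpb i ≤ z.price j := by
  by_cases hij : Arc u i j
  · exact h.bpb i j hij
  · exact (mul_nonpos_of_nonpos_of_nonneg (not_lt.1 hij) (h.invBpb_nonneg i)).trans
      (h.price_pos j).le

theorem of_sums (hin : ∀ j, ∑ i, z.pay i j = z.price j) (hout : ∀ i, ∑ j, z.pay i j = z.price i)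
    (hbpb : ∀ i j, Arc u i j → u i j * z.invBpb i ≤ z.price j) (hprice : ∀ i, 1 ≤ z.price i)
    (hpay : ∀ i j, 0 ≤ z.pay i j) (hinvBpb : ∀ i, 0 ≤ z.invBpb i)
    (harc : ∀ i j, ¬Arc u i j → z.pay i j = 0) : IsFeasible u z where
  inflow j := by
    rw [← hin, Finset.sum_filter_of_ne fun i _ => not_imp_comm.1 (harc i j)]
  outflow i := by
    rw [← hout, Finset.sum_filter_of_ne fun j _ => not_imp_comm.1 (harc i j)]
  bpb := hbpb
  one_le_price := hprice
  pay_nonneg i j _ := hpay i j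
  invBpb_nonneg := hinvBpb
  pay_arc := harc

end IsFeasible

theorem feasibleSet_eq_polyhedron (hs : ∀ i j, 0 < s i j) (ht : t = s * u⁺) :
    feasibleSet u =
      polyhedron (fun r => row s t r ∘ₗ coords.toLinearMap) (rowBound ℝ) (eqRows u) := by
  have hbpb (z : Vars A) (i j : A) :
      0 ≤ s i j * z.price j - t i j * z.invBpb i ↔ (u i j)⁺ * z.invBpb i ≤ z.price j := by
    rw [ht, Pi.mul_apply, Pi.mul_apply, mul_assoc, ← mul_sub, mul_nonneg_iff_of_pos_left (hs i j),
      sub_nonneg]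
    rfl
  ext z
  refine ⟨fun h => ⟨?_, ?_⟩, fun ⟨h, hE⟩ => ?_⟩
  · rintro ((⟨i, j⟩ | i | i) | j | i | ⟨i, j⟩)
    · exact h.zero_le_pay i j
    · exact h.one_le_price i
    · exact h.invBpb_nonneg i
    · simp [row, coords, rowBound, h.sum_inflow j]
    · simp [row, coords, rowBound, h.sum_outflow i]
    · refine (hbpb z i j).2 ?_
      rw [posPart_def, max_mul_of_nonneg _ _ (h.invBpb_nonneg i), zero_mul]
      exact max_le (h.mul_invBpb_le_price i j) (h.price_pos j).le
  · rintro ((⟨i, j⟩ | i | i) | j | i | ⟨i, j⟩) hr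
    · exact h.pay_arc i j hr
    · exact hr.elim
    · exact hr.elim
    · simp [row, coords, rowBound, h.sum_inflow j]
    · simp [row, coords, rowBound, h.sum_outflow i]
    · exact hr.elim
  · refine .of_sums (fun j => ?_) (fun i => ?_) (fun i j hij => ?_) (fun i => h (.coord (.price i)))
      (fun i j => h (.coord (.pay i j))) (fun i => h (.coord (.invBpb i)))
      fun i j hij => hE (.coord (.pay i j)) hij
    · simpa [row, coords, rowBound, sub_eq_zero] using hE (.inflow j) trivial
    · simpa [row, coords, rowBound, sub_eq_zero] using hE (.outflow i) trivial
    · rw [← posPart_of_nonneg (le_of_lt hij)]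
      exact (hbpb z i j).1 (h (.bpb i j))

theorem feasibleSet_eq_polyhedron_posPart : feasibleSet u =
    polyhedron (fun r => row 1 u⁺ r ∘ₗ coords.toLinearMap) (rowBound ℝ) (eqRows u) :=
  feasibleSet_eq_polyhedron (fun _ _ => one_pos) (one_mul _).symm

theorem convex_feasibleSet : Convex ℝ (feasibleSet u) :=
  feasibleSet_eq_polyhedron_posPart (u := u) ▸ convex_polyhedron

theorem isClosed_feasibleSet : IsClosed (feasibleSet u) :=
  feasibleSet_eq_polyhedron_posPart (u := u) ▸ isClosed_polyhedron

end ConstraintSystem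

section Objective

theorem convexOn_perspective {V : Type*} [AddCommGroup V] [Module ℝ V] {S : Set V} {f : V → ℝ}
    (hf : ConvexOn ℝ S f) :
    ConvexOn ℝ {x : V × ℝ | 0 < x.2 ∧ x.2⁻¹ • x.1 ∈ S} fun x => x.2 * f (x.2⁻¹ • x.1) := by
  have key : ∀ ⦃x : V × ℝ⦄, 0 < x.2 ∧ x.2⁻¹ • x.1 ∈ S → ∀ ⦃y : V × ℝ⦄, 0 < y.2 ∧ y.2⁻¹ • y.1 ∈ S →
      ∀ ⦃a b : ℝ⦄, 0 ≤ a → 0 ≤ b → a + b = 1 →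
      0 < a * x.2 + b * y.2 ∧ (a * x.2 + b * y.2)⁻¹ • (a • x.1 + b • y.1) ∈ S ∧
        (a * x.2 + b * y.2) * f ((a * x.2 + b * y.2)⁻¹ • (a • x.1 + b • y.1)) ≤
          a * (x.2 * f (x.2⁻¹ • x.1)) + b * (y.2 * f (y.2⁻¹ • y.1)) := by
    rintro ⟨x, s⟩ ⟨hs, hx⟩ ⟨y, t⟩ ⟨ht, hy⟩ a b ha hb hab
    dsimp only at hs hx ht hy ⊢
    have hT : 0 < a * s + b * t := convex_Ioi (0 : ℝ) hs ht ha hb hab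
    set T := a * s + b * t
    have hcomb : T⁻¹ • (a • x + b • y) = (a * s / T) • s⁻¹ • x + (b * t / T) • t⁻¹ • y := by
      rw [smul_smul, smul_smul, smul_add, smul_smul, smul_smul]
      congr 2 <;> field_simp
    have hweights : a * s / T + b * t / T = 1 := by rw [← add_div, div_self hT.ne']
    have hS := hf.1 hx hy (by positivity) (by positivity) hweights
    have hle := hf.2 hx hy (by positivity) (by positivity) hweights
    rw [hcomb]
    refine ⟨hT, hS, (mul_le_mul_of_nonneg_left hle hT.le).trans_eq ?_⟩
    rw [smul_eq_mul, smul_eq_mul]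
    field_simp
  exact ⟨fun x hx y hy a b ha hb hab => ⟨(key hx hy ha hb hab).1, (key hx hy ha hb hab).2.1⟩,
    fun x hx y hy a b ha hb hab => (key hx hy ha hb hab).2.2⟩

theorem convexOn_mul_log_div :
    ConvexOn ℝ {x : ℝ × ℝ | 0 < x.1 ∧ 0 < x.2} fun x => x.1 * Real.log (x.1 / x.2) := by
  have hconv : Convex ℝ {x : ℝ × ℝ | 0 < x.1 ∧ 0 < x.2} := (convex_Ioi 0).prod (convex_Ioi 0)
  refine ((convexOn_perspective Real.convexOn_mul_log).subset (fun x hx => ⟨hx.2, ?_⟩)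
    hconv).congr fun x hx => ?_
  · exact mul_nonneg (inv_nonneg.2 hx.2.le) hx.1.le
  · have hx2 : x.2 ≠ 0 := hx.2.ne'
    simp only [smul_eq_mul, ← div_eq_inv_mul]
    rw [← mul_assoc, mul_div_cancel₀ _ hx2]

variable {A : Type*} {u : A → A → ℝ} {z : Vars A}

/-- The logarithm of the factor by which buying good `j` falls short of the bang-per-buck `1 / β i`
of agent `i`. -/
noncomputable def logGap (u : A → A → ℝ) (z : Vars A) (i j : A) : ℝ :=
  Real.log (z.price j) - Real.log (z.invBpb i) - Real.log (u i j)

theorem logGap_eq_log_sub_log {i j : A} (hij : Arc u i j) (hi : 0 < z.invBpb i) :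
    logGap u z i j = Real.log (z.price j) - Real.log (u i j * z.invBpb i) := by
  rw [logGap, Real.log_mul (ne_of_gt hij) hi.ne']
  ring

variable [Fintype A]

/-- The objective at points with positive `β`, where it is finite. -/
noncomputable def realObjective (u : A → A → ℝ) (z : Vars A) : ℝ :=
  ∑ i, z.price i * Real.log (z.price i / z.invBpb i) - ∑ i, ∑ j, z.pay i j * Real.log (u i j)

theorem relEntropy_ne_bot (p b : ℝ) : relEntropy p b ≠ ⊥ := by
  unfold relEntropy
  split_ifs
  exacts [top_ne_bot, EReal.coe_ne_bot _]

theorem objective_eq_top (h : IsFeasible u z) {i : A} (hi : z.invBpb i = 0) :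
    objective u z = ⊤ := by
  classical
  have htop : relEntropy (z.price i) (z.invBpb i) = ⊤ := if_pos ⟨hi, (h.price_pos i).ne'⟩
  have hbot : ∑ k ∈ Finset.univ.erase i, relEntropy (z.price k) (z.invBpb k) ≠ ⊥ :=
    Finset.sum_induction _ (· ≠ ⊥) (fun _ _ ha hb => EReal.add_ne_bot_iff.2 ⟨ha, hb⟩)
      EReal.zero_ne_bot fun _ _ => relEntropy_ne_bot _ _
  rw [objective, ← Finset.add_sum_erase _ _ (Finset.mem_univ i), htop, EReal.top_add_of_ne_bot hbot]
  exact EReal.top_sub_coe _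

theorem objective_eq_coe (h : IsFeasible u z) (hβ : ∀ i, 0 < z.invBpb i) :
    objective u z = (realObjective u z : ℝ) := by
  have hentropy (i : A) : relEntropy (z.price i) (z.invBpb i) =
      ((z.price i * Real.log (z.price i / z.invBpb i) : ℝ) : EReal) :=
    if_neg fun hn => (hβ i).ne' hn.1
  have hpay (i : A) : ∑ j with Arc u i j, z.pay i j * Real.log (u i j) =
      ∑ j, z.pay i j * Real.log (u i j) :=
    Finset.sum_filter_of_ne fun j _ hj => h.arc_of_pay_ne_zero (left_ne_zero_of_mul hj)
  have hcoe (f : A → ℝ) : ∑ i, (f i : EReal) = ((∑ i, f i : ℝ) : EReal) :=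
    (map_sum (⟨⟨Real.toEReal, EReal.coe_zero⟩, EReal.coe_add⟩ : ℝ →+ EReal) f Finset.univ).symm
  simp only [objective, hentropy, hpay, realObjective, EReal.coe_sub, hcoe]

theorem objective_cases (h : IsFeasible u z) :
    (objective u z = ⊤ ∧ ∃ i, z.invBpb i = 0) ∨
      ((∀ i, 0 < z.invBpb i) ∧ objective u z = (realObjective u z : ℝ)) := by
  by_cases hz : ∃ i, z.invBpb i = 0
  · obtain ⟨i, hi⟩ := hz
    exact .inl ⟨objective_eq_top h hi, i, hi⟩
  · push Not at hz
    have hβ (i : A) : 0 < z.invBpb i := (h.invBpb_nonneg i).lt_of_ne' (hz i)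
    exact .inr ⟨hβ, objective_eq_coe h hβ⟩

theorem convexOn_realObjective :
    ConvexOn ℝ {z : Vars A | ∀ i, 0 < z.price i ∧ 0 < z.invBpb i} (realObjective u) := by
  have hset : Convex ℝ {z : Vars A | ∀ i, 0 < z.price i ∧ 0 < z.invBpb i} :=
    fun z hz w hw a b ha hb hab i => ⟨convex_Ioi (0 : ℝ) (hz i).1 (hw i).1 ha hb hab,
      convex_Ioi (0 : ℝ) (hz i).2 (hw i).2 ha hb hab⟩
  refine ⟨hset, fun z hz w hw a b ha hb hab => ?_⟩
  have hentropy := Finset.sum_le_sum fun i (_ : i ∈ Finset.univ) =>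
    convexOn_mul_log_div.2 (x := (z.price i, z.invBpb i)) (y := (w.price i, w.invBpb i))
      (hz i) (hw i) ha hb hab
  have hpay : ∑ i, ∑ j, (a • z + b • w).pay i j * Real.log (u i j) =
      a * ∑ i, ∑ j, z.pay i j * Real.log (u i j) + b * ∑ i, ∑ j, w.pay i j * Real.log (u i j) := by
    simp only [Finset.mul_sum, ← Finset.sum_add_distrib]
    exact Finset.sum_congr rfl fun i _ => Finset.sum_congr rfl fun j _ =>
      (add_mul _ _ _).trans (congrArg₂ _ (mul_assoc _ _ _) (mul_assoc _ _ _))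
  rw [Finset.sum_add_distrib, ← Finset.smul_sum, ← Finset.smul_sum] at hentropy
  calc realObjective u (a • z + b • w) ≤ _ := sub_le_sub hentropy hpay.ge
    _ = a • realObjective u z + b • realObjective u w := by
      simp only [realObjective, smul_eq_mul]
      ring

theorem realObjective_eq_sum_pay_mul_logGap (h : IsFeasible u z) (hβ : ∀ i, 0 < z.invBpb i) :
    realObjective u z = ∑ i, ∑ j, z.pay i j * logGap u z i j := by
  have hin : ∑ i, ∑ j, z.pay i j * Real.log (z.price j) =
      ∑ j, z.price j * Real.log (z.price j) := by
    rw [Finset.sum_comm]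
    exact Finset.sum_congr rfl fun j _ => by rw [← Finset.sum_mul, h.sum_inflow]
  have hout : ∑ i, ∑ j, z.pay i j * Real.log (z.invBpb i) =
      ∑ i, z.price i * Real.log (z.invBpb i) :=
    Finset.sum_congr rfl fun i _ => by rw [← Finset.sum_mul, h.sum_outflow]
  have hlog (i : A) : Real.log (z.price i / z.invBpb i) =
      Real.log (z.price i) - Real.log (z.invBpb i) :=
    Real.log_div (h.price_pos i).ne' (hβ i).ne'
  simp only [realObjective, logGap, hlog, mul_sub, Finset.sum_sub_distrib, hin, hout]

theorem pay_mul_logGap_nonneg (h : IsFeasible u z) (hβ : ∀ i, 0 < z.invBpb i) (i j : A) :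
    0 ≤ z.pay i j * logGap u z i j := by
  by_cases hij : Arc u i j
  · refine mul_nonneg (h.zero_le_pay i j) ?_
    rw [logGap_eq_log_sub_log hij (hβ i)]
    exact sub_nonneg.2 (Real.log_le_log (mul_pos hij (hβ i)) (h.bpb i j hij))
  · rw [h.pay_arc i j hij, zero_mul]

theorem realObjective_nonneg (h : IsFeasible u z) (hβ : ∀ i, 0 < z.invBpb i) :
    0 ≤ realObjective u z := by
  rw [realObjective_eq_sum_pay_mul_logGap h hβ]
  exact Finset.sum_nonneg fun i _ => Finset.sum_nonneg fun j _ => pay_mul_logGap_nonneg h hβ i j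

theorem pay_mul_logGap_le_realObjective (h : IsFeasible u z) (hβ : ∀ i, 0 < z.invBpb i) (i j : A) :
    z.pay i j * logGap u z i j ≤ realObjective u z := by
  rw [realObjective_eq_sum_pay_mul_logGap h hβ]
  have hrow (k : A) : 0 ≤ ∑ l, z.pay k l * logGap u z k l :=
    Finset.sum_nonneg fun l _ => pay_mul_logGap_nonneg h hβ k l
  calc z.pay i j * logGap u z i j ≤ ∑ l, z.pay i l * logGap u z i l :=
        Finset.single_le_sum (f := fun l => z.pay i l * logGap u z i l)
          (fun l _ => pay_mul_logGap_nonneg h hβ i l) (Finset.mem_univ j)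
    _ ≤ _ := Finset.single_le_sum (f := fun k => ∑ l, z.pay k l * logGap u z k l)
        (fun k _ => hrow k) (Finset.mem_univ i)

theorem realObjective_eq_zero_iff (h : IsFeasible u z) (hβ : ∀ i, 0 < z.invBpb i) :
    realObjective u z = 0 ↔ ∀ i j, z.pay i j ≠ 0 → u i j * z.invBpb i = z.price j := by
  have hterm (i j : A) : z.pay i j * logGap u z i j = 0 ↔
      (z.pay i j ≠ 0 → u i j * z.invBpb i = z.price j) := by
    rw [mul_eq_zero, or_iff_not_imp_left]
    refine forall_congr' fun hij => ?_
    have harc := h.arc_of_pay_ne_zero hij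
    rw [logGap_eq_log_sub_log harc (hβ i), sub_eq_zero, eq_comm]
    exact Real.log_injOn_pos.eq_iff (mul_pos harc (hβ i)) (h.price_pos j)
  rw [realObjective_eq_sum_pay_mul_logGap h hβ, Finset.sum_eq_zero_iff_of_nonneg fun i _ =>
    Finset.sum_nonneg fun j _ => pay_mul_logGap_nonneg h hβ i j]
  simp only [Finset.mem_univ, true_imp_iff, ← hterm]
  exact forall_congr' fun i => by
    simp only [Finset.sum_eq_zero_iff_of_nonneg fun j _ => pay_mul_logGap_nonneg h hβ i j,
      Finset.mem_univ, true_imp_iff]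

theorem objective_nonneg (h : IsFeasible u z) : 0 ≤ objective u z := by
  rcases objective_cases h with ⟨htop, -⟩ | ⟨hβ, hcoe⟩
  · exact htop ▸ le_top
  · exact hcoe ▸ EReal.coe_nonneg.2 (realObjective_nonneg h hβ)

theorem objective_nonpos_iff (h : IsFeasible u z) :
    objective u z ≤ 0 ↔
      (∀ i, 0 < z.invBpb i) ∧ ∀ i j, z.pay i j ≠ 0 → u i j * z.invBpb i = z.price j := by
  rcases objective_cases h with ⟨htop, i, hi⟩ | ⟨hβ, hcoe⟩
  · exact ⟨fun hle => absurd hle (by simp [htop]), fun hpos => absurd (hpos.1 i) (by simp [hi])⟩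
  · rw [hcoe, ← realObjective_eq_zero_iff h hβ, EReal.coe_nonpos]
    exact ⟨fun hle => ⟨hβ, hle.antisymm (realObjective_nonneg h hβ)⟩, fun hz => hz.2.le⟩

theorem isConvexProgram : IsConvexProgram u := by
  refine ⟨convex_feasibleSet, fun z hz w hw a b ha hb hab => ?_⟩
  rcases ha.eq_or_lt with rfl | ha
  · obtain rfl : b = 1 := by linarith
    simp
  rcases hb.eq_or_lt with rfl | hb
  · obtain rfl : a = 1 := by linarith
    simp
  have hne {c : ℝ} {v : Vars A} (hc : 0 < c) (hv : IsFeasible u v) :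
      (c : EReal) * objective u v ≠ ⊥ :=
    (EReal.bot_lt_zero.trans_le (mul_nonneg (EReal.coe_nonneg.2 hc.le) (objective_nonneg hv))).ne'
  rcases objective_cases hz with ⟨hztop, -⟩ | ⟨hzβ, hzcoe⟩
  · rw [hztop, EReal.coe_mul_top_of_pos ha, EReal.top_add_of_ne_bot (hne hb hw)]
    exact le_top
  rcases objective_cases hw with ⟨hwtop, -⟩ | ⟨hwβ, hwcoe⟩
  · rw [hwtop, EReal.coe_mul_top_of_pos hb, EReal.add_top_of_ne_bot (hne ha hz)]
    exact le_top
  have hconv := convexOn_realObjective (u := u).2 (fun i => ⟨hz.price_pos i, hzβ i⟩)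
    (fun i => ⟨hw.price_pos i, hwβ i⟩) ha.le hb.le hab
  rw [hzcoe, hwcoe, objective_eq_coe (convex_feasibleSet hz hw ha.le hb.le hab) fun i =>
    add_pos (mul_pos ha (hzβ i)) (mul_pos hb (hwβ i))]
  exact_mod_cast hconv

theorem isEquilibrium_of_objective_nonpos (h : IsFeasible u z) (h0 : objective u z ≤ 0) :
    IsEquilibrium u z.price fun i j => z.pay i j / z.price j := by
  obtain ⟨hβ, htight⟩ := (objective_nonpos_iff h).1 h0
  have hprice (j : A) : z.price j ≠ 0 := (h.price_pos j).ne'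
  have halloc (i j : A) : u i j * (z.pay i j / z.price j) * z.invBpb i = z.pay i j := by
    by_cases hij : z.pay i j = 0
    · simp [hij]
    · rw [mul_right_comm, htight i j hij, mul_div_cancel₀ _ (hprice j)]
  refine ⟨h.price_pos, fun i j => div_nonneg (h.zero_le_pay i j) (h.price_pos j).le,
    fun i j hij => by rw [h.pay_arc i j hij, zero_div],
    fun j => by rw [← Finset.sum_div, h.sum_inflow, div_self (hprice j)],
    fun i => by simp only [div_mul_cancel₀ _ (hprice _), h.sum_outflow],
    fun i b hb hbudget => ?_, fun i j hij k => ?_⟩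
  · refine le_of_mul_le_mul_right ?_ (hβ i)
    calc (∑ j, u i j * b j) * z.invBpb i = ∑ j, b j * (u i j * z.invBpb i) := by
          rw [Finset.sum_mul]
          exact Finset.sum_congr rfl fun j _ => by ring
      _ ≤ ∑ j, b j * z.price j := Finset.sum_le_sum fun j _ =>
          mul_le_mul_of_nonneg_left (h.mul_invBpb_le_price i j) (hb j)
      _ ≤ z.price i := hbudget
      _ = (∑ j, u i j * (z.pay i j / z.price j)) * z.invBpb i := by
          simp only [Finset.sum_mul, halloc, h.sum_outflow]
  · have hij' : z.pay i j ≠ 0 := (div_ne_zero_iff.1 hij.ne').1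
    rw [div_le_div_iff₀ (h.price_pos k) (h.price_pos j), ← htight i j hij', mul_left_comm]
    exact mul_le_mul_of_nonneg_left (h.mul_invBpb_le_price i k)
      (le_of_lt (h.arc_of_pay_ne_zero hij'))

end Objective

section Flow

variable {A : Type*} [Fintype A] {r : A → A → Prop} {f g : A → A → ℝ} {s t : A → ℝ} {a b i j : A}

/-- `f` is a nonnegative flow along the relation `r` in which `s i` is the outflow minus the inflow
of the node `i`; a circulation is a flow with `s = 0`. -/
structure IsFlow (r : A → A → Prop) (f : A → A → ℝ) (s : A → ℝ) : Prop where
  nonneg : ∀ i j, 0 ≤ f i j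
  rel : ∀ i j, f i j ≠ 0 → r i j
  net : ∀ i, ∑ j, f i j - ∑ j, f j i = s i

namespace IsFlow

theorem zero : IsFlow r 0 0 := ⟨fun _ _ => le_rfl, fun _ _ h => absurd rfl h, fun _ => by simp⟩

theorem add (hf : IsFlow r f s) (hg : IsFlow r g t) : IsFlow r (f + g) (s + t) where
  nonneg i j := add_nonneg (hf.nonneg i j) (hg.nonneg i j)
  rel i j h := by
    by_cases hij : f i j = 0
    · exact hg.rel i j fun hg0 => h (by simp [hij, hg0])
    · exact hf.rel i j hij
  net i := by
    simp only [Pi.add_apply, Finset.sum_add_distrib, ← hf.net i, ← hg.net i]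
    ring

theorem sum {ι : Type*} [Fintype ι] {f : ι → A → A → ℝ} (hf : ∀ k, IsFlow r (f k) 0) :
    IsFlow r (∑ k, f k) 0 :=
  Finset.sum_induction f (IsFlow r · 0) (fun _ _ hf hg => add_zero (0 : A → ℝ) ▸ hf.add hg) zero
    fun k _ => hf k

theorem single [DecidableEq A] (hab : r a b) :
    IsFlow r (Pi.single a (Pi.single b 1)) (Pi.single a 1 - Pi.single b 1) where
  nonneg i j := by
    simp only [Pi.single_apply, ite_apply, Pi.zero_apply]
    positivity
  rel i j h := by
    by_cases hi : i = a
    · by_cases hj : j = b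
      · exact hi ▸ hj ▸ hab
      · simp [hi, hj] at h
    · simp [hi] at h
  net i := by
    by_cases hi : i = a <;> simp [Pi.single_apply, ite_apply, hi]

/-- A set closed under `r` has no outflow in a circulation, hence no inflow. -/
theorem reflTransGen_of_ne_zero (h : IsFlow r f 0) (hij : f i j ≠ 0) :
    Relation.ReflTransGen r j i := by
  classical
  by_contra hn
  set S : Finset A := {k | Relation.ReflTransGen r j k}
  have hi : i ∈ Sᶜ := by simpa [S] using hn
  have hj : j ∈ S := by simp [S, Relation.ReflTransGen.refl]
  have hclosed {k l : A} (hk : k ∈ S) (hkl : r k l) : l ∈ S := by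
    simp only [S, Finset.mem_filter_univ] at hk ⊢
    exact hk.tail hkl
  have hout (k : A) (hk : k ∈ S) : ∑ l ∈ S, f k l = ∑ l, f k l :=
    Finset.sum_subset S.subset_univ fun l _ hl => not_imp_comm.1 (hclosed hk ∘ h.rel k l) hl
  have hinflow : ∑ k ∈ S, ∑ l ∈ Sᶜ, f l k = 0 := by
    have hbalance : ∑ k ∈ S, (∑ l, f k l - ∑ l, f l k) = 0 :=
      Finset.sum_eq_zero fun k _ => h.net k
    rw [Finset.sum_sub_distrib, ← Finset.sum_congr rfl hout, sub_eq_zero,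
      Finset.sum_comm] at hbalance
    simp only [← Finset.sum_add_sum_compl S, Finset.sum_add_distrib] at hbalance
    exact left_eq_add.1 hbalance
  have hpos : 0 < ∑ k ∈ S, ∑ l ∈ Sᶜ, f l k :=
    ((h.nonneg i j).lt_of_ne' hij).trans_le <|
      (Finset.single_le_sum (f := fun l => f l j) (fun l _ => h.nonneg l j) hi).trans
        (Finset.single_le_sum (f := fun k => ∑ l ∈ Sᶜ, f l k)
          (fun k _ => Finset.sum_nonneg fun l _ => h.nonneg l k) hj)
  exact hpos.ne' hinflow

end IsFlow

theorem exists_isFlow_of_reflTransGen [DecidableEq A] (h : Relation.ReflTransGen r a b) :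
    ∃ f, IsFlow r f (Pi.single a 1 - Pi.single b 1) := by
  induction h with
  | refl => exact ⟨0, by simpa using .zero⟩
  | tail _ hbc ih =>
    obtain ⟨f, hf⟩ := ih
    exact ⟨_, by simpa using hf.add (.single hbc)⟩

theorem exists_circulation_through (hab : r a b) (hba : Relation.ReflTransGen r b a) :
    ∃ f, IsFlow r f 0 ∧ 1 ≤ f a b := by
  classical
  obtain ⟨f, hf⟩ := exists_isFlow_of_reflTransGen hba
  refine ⟨_, by simpa using hf.add (.single hab), ?_⟩
  simpa using hf.nonneg a b

theorem exists_circulation_one_le_outflow (h : ∀ i, ∃ j, r i j ∧ Relation.ReflTransGen r j i) :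
    ∃ f, IsFlow r f 0 ∧ ∀ i, 1 ≤ ∑ j, f i j := by
  choose b hab hba using h
  choose f hf hf1 using fun a => exists_circulation_through (hab a) (hba a)
  refine ⟨∑ a, f a, .sum hf, fun i => ?_⟩
  calc 1 ≤ f i i (b i) := hf1 i
    _ ≤ (∑ a, f a) i (b i) := by
      simp only [Finset.sum_apply]
      exact Finset.single_le_sum (f := fun a => f a i (b i)) (fun a _ => (hf a).nonneg _ _)
        (Finset.mem_univ i)
    _ ≤ ∑ j, (∑ a, f a) i j := Finset.single_le_sum (f := (∑ a, f a) i)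
        (fun j _ => (IsFlow.sum hf).nonneg i j) (Finset.mem_univ (b i))

end Flow

section Feasibility

variable {A : Type*} {u : A → A → ℝ}

theorem singletonComponentsHaveLoops_iff : SingletonComponentsHaveLoops u ↔
    ∀ i, ∃ j, Arc u i j ∧ Relation.ReflTransGen (Arc u) j i := by
  have hself (i : A) : i ∈ scc u i := ⟨.refl, .refl⟩
  have hsingleton {i : A} (hi : (scc u i).ncard = 1) : ∀ j ∈ scc u i, j = i := by
    obtain ⟨k, hk⟩ := Set.ncard_eq_one.1 hi
    have hik := hself i
    rw [hk] at hik ⊢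
    exact fun j hj => hj.trans hik.symm
  constructor <;> intro h i
  · by_cases hi : (scc u i).ncard = 1
    · obtain ⟨k, hk, hkk⟩ := h i hi
      obtain rfl := hsingleton hi k hk
      exact ⟨k, hkk, .refl⟩
    · obtain ⟨k, hk, hki⟩ : ∃ k ∈ scc u i, k ≠ i := by
        by_contra! hn
        exact hi (Set.ncard_eq_one.2 ⟨i, Set.eq_singleton_iff_unique_mem.2 ⟨hself i, hn⟩⟩)
      obtain ⟨j, hij, hjk⟩ := hk.1.cases_head.resolve_left hki.symm
      exact ⟨j, hij, hjk.trans hk.2⟩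
  · intro hi
    obtain ⟨j, hij, hji⟩ := h i
    have hj : j ∈ scc u i := ⟨.single hij, hji⟩
    exact ⟨j, hj, by simpa [hsingleton hi j hj] using hij⟩

theorem exists_pos_forall_le [Finite A] (f : A → A → ℝ) : ∃ c > 0, ∀ i j, f i j ≤ c := by
  obtain ⟨c, hc⟩ := (Set.finite_range fun x : A × A => f x.1 x.2).bddAbove
  exact ⟨max c 1, by positivity, fun i j => le_max_of_le_left (hc ⟨(i, j), rfl⟩)⟩

variable [Fintype A] {z : Vars A}

theorem IsFeasible.isFlow (h : IsFeasible u z) : IsFlow (Arc u) z.pay 0 where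
  nonneg := h.zero_le_pay
  rel _ _ := h.arc_of_pay_ne_zero
  net i := by rw [h.sum_outflow, h.sum_inflow, sub_self, Pi.zero_apply]

theorem IsFeasible.singletonComponentsHaveLoops (h : IsFeasible u z) :
    SingletonComponentsHaveLoops u := by
  refine singletonComponentsHaveLoops_iff.2 fun i => ?_
  obtain ⟨j, -, hj⟩ : ∃ j ∈ Finset.univ, z.pay i j ≠ 0 := Finset.exists_ne_zero_of_sum_ne_zero <| by
    rw [h.sum_outflow]
    exact (h.price_pos i).ne'
  exact ⟨j, h.arc_of_pay_ne_zero hj, h.isFlow.reflTransGen_of_ne_zero hj⟩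

theorem IsFlow.exists_isFeasible {f : A → A → ℝ} (hf : IsFlow (Arc u) f 0)
    (hf1 : ∀ i, 1 ≤ ∑ j, f i j) : ∃ z, IsFeasible u z ∧ ∀ i, 0 < z.invBpb i := by
  obtain ⟨c, hc, hu⟩ := exists_pos_forall_le u
  refine ⟨(f, fun i => ∑ j, f i j, fun _ => c⁻¹), .of_sums (fun j => ?_) (fun _ => rfl)
    (fun i j _ => ?_) hf1 hf.nonneg (fun _ => (inv_pos.2 hc).le)
    (fun i j hij => by_contra fun hne => hij (hf.rel i j hne)), fun _ => inv_pos.2 hc⟩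
  · exact (sub_eq_zero.1 (hf.net j)).symm
  · exact (mul_inv_le_one_of_le₀ (hu i j) hc.le).trans (hf1 j)

theorem SingletonComponentsHaveLoops.exists_isFeasible (h : SingletonComponentsHaveLoops u) :
    ∃ z, IsFeasible u z ∧ ∀ i, 0 < z.invBpb i :=
  let ⟨_, hf, hf1⟩ := exists_circulation_one_le_outflow (singletonComponentsHaveLoops_iff.1 h)
  hf.exists_isFeasible hf1

theorem nonempty_feasibleSet_iff : (feasibleSet u).Nonempty ↔ SingletonComponentsHaveLoops u :=
  ⟨fun ⟨_, hz⟩ => IsFeasible.singletonComponentsHaveLoops hz,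
    fun h => h.exists_isFeasible.imp fun _ hz => hz.1⟩

end Feasibility

section Duality

variable {A : Type*} [Fintype A] {u : A → A → ℝ} {z : Vars A}

/-- The gradient of the objective, in coordinates. -/
noncomputable def objectiveGrad (u : A → A → ℝ) (z : Vars A) : Coord A → ℝ
  | .pay i j => -Real.log (u i j)
  | .price i => Real.log (z.price i / z.invBpb i) + 1
  | .invBpb i => -(z.price i / z.invBpb i)

theorem hasFDerivAt_mul_log_div {x : ℝ × ℝ} (h1 : x.1 ≠ 0) (h2 : x.2 ≠ 0) :
    HasFDerivAt (fun x : ℝ × ℝ => x.1 * Real.log (x.1 / x.2))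
      ((Real.log (x.1 / x.2) + 1) • ContinuousLinearMap.fst ℝ ℝ ℝ -
        (x.1 / x.2) • ContinuousLinearMap.snd ℝ ℝ ℝ) x := by
  have hinv := (hasDerivAt_inv h2).comp_hasFDerivAt x (hasFDerivAt_snd (𝕜 := ℝ) (E := ℝ) (F := ℝ))
  refine (hasFDerivAt_fst.mul ((hasFDerivAt_fst.mul hinv).log
    (mul_ne_zero h1 (inv_ne_zero h2)))).congr_fderiv ?_
  ext <;> simp <;> field_simp
  exact add_comm _ _

theorem hasFDerivAt_realObjective (hp : ∀ i, 0 < z.price i) (hβ : ∀ i, 0 < z.invBpb i) :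
    HasFDerivAt (realObjective u) (LinearMap.toContinuousLinearMap
      (∑ k, objectiveGrad u z k • (LinearMap.proj k ∘ₗ coords.toLinearMap))) z := by
  have hentropy (i : A) := (hasFDerivAt_mul_log_div (hp i).ne' (hβ i).ne').comp z
    (HasFDerivAt.prodMk ((hasFDerivAt_apply i _).comp z (hasFDerivAt_snd.fst))
      ((hasFDerivAt_apply i _).comp z (hasFDerivAt_snd.snd)))
  have hpay (i j : A) :=
    (((ContinuousLinearMap.proj j).comp ((ContinuousLinearMap.proj i).comp
      (ContinuousLinearMap.fst ℝ (A → A → ℝ) ((A → ℝ) × (A → ℝ))))).hasFDerivAt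
      (x := z)).mul_const (Real.log (u i j))
  refine ((HasFDerivAt.fun_sum fun i _ => hentropy i).sub
    (HasFDerivAt.fun_sum fun i _ => HasFDerivAt.fun_sum fun j _ => hpay i j)).congr_fderiv
    (ContinuousLinearMap.ext fun d => ?_)
  simp [sum_coord, objectiveGrad, coords]
  ring

theorem sum_objectiveGrad_mul_coords (hβ : ∀ i, 0 < z.invBpb i) :
    ∑ k, objectiveGrad u z k * coords z k = realObjective u z := by
  have hcancel (i : A) : z.price i / z.invBpb i * z.invBpb i = z.price i :=
    div_mul_cancel₀ _ (hβ i).ne'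
  simp only [sum_coord, realObjective, objectiveGrad, coords, LinearEquiv.coe_mk, LinearMap.coe_mk,
    AddHom.coe_mk, add_mul, one_mul, neg_mul, hcancel, Finset.sum_add_distrib,
    Finset.sum_neg_distrib]
  simp only [mul_comm]
  ring

/-- Karush–Kuhn–Tucker multipliers of the convex program at `z`: `a` and `b` belong to the inflow
and outflow equations, `τ` to the constraints `1 ≤ p i` and `w` to the bang-per-buck
inequalities. -/
structure IsDualSolution (u : A → A → ℝ) (z : Vars A) (a b τ : A → ℝ) (w : A → A → ℝ) : Prop where
  price_nonneg : ∀ i, 0 ≤ τ i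
  bpb_nonneg : ∀ i j, 0 ≤ w i j
  pay : ∀ i j, Arc u i j → Real.log (u i j) + a j + b i ≤ 0
  price : ∀ i, Real.log (z.price i / z.invBpb i) + 1 + a i + b i = τ i + ∑ k, w k i
  invBpb : ∀ i, z.price i / z.invBpb i = ∑ j, w i j * (u i j)⁺
  realObjective_eq : realObjective u z = ∑ i, τ i

theorem exists_isDualSolution (h : IsFeasible u z) (hβ : ∀ i, 0 < z.invBpb i)
    (hmin : IsLocalMinOn (realObjective u) (feasibleSet u) z) :
    ∃ a b τ w, IsDualSolution u z a b τ w := by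
  classical
  have hz : z ∈ feasibleSet u := h
  rw [feasibleSet_eq_polyhedron_posPart] at hz hmin
  obtain ⟨l, hl, hslack, hgrad⟩ :=
    exists_multipliers_of_isLocalMinOn hmin (hasFDerivAt_realObjective h.price_pos hβ) hz
  have hdual (k : Coord A) : objectiveGrad u z k = ∑ r, l r * row 1 u⁺ r (Pi.single k 1) := by
    simpa [Pi.single_apply] using hgrad (coords.symm (Pi.single k 1))
  have hinvBpb (i : A) : l (.coord (.invBpb i)) = 0 :=
    (mul_eq_zero.1 ((hslack (.coord (.invBpb i))).trans (mul_zero _))).resolve_right (hβ i).ne'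
  refine ⟨fun j => l (.inflow j), fun i => l (.outflow i), fun i => l (.coord (.price i)),
    fun i j => l (.bpb i j), fun i => hl _ id, fun i j => hl _ id, fun i j hij => ?_, fun i => ?_,
    fun i => ?_, ?_⟩
  · have hk := hdual (.pay i j)
    rw [sum_row] at hk
    simp [row, Pi.single_apply, objectiveGrad, ite_and] at hk
    have hpay_nonneg := hl (.coord (.pay i j)) (not_not.2 hij)
    linarith
  · have hk := hdual (.price i)
    rw [sum_row] at hk
    simp [row, Pi.single_apply, objectiveGrad] at hk
    linarith
  · have hk := hdual (.invBpb i)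
    rw [sum_row] at hk
    simpa [row, Pi.single_apply, objectiveGrad, hinvBpb] using hk
  · rw [← sum_objectiveGrad_mul_coords hβ]
    have hz := hgrad z
    simp only [hslack] at hz
    simpa [sum_row, sum_coord, rowBound] using hz

-- Weak duality: `log x ≤ x - 1` at `x = (p i / β i) * exp (a i + b i)` turns
-- the dual equations into `∑ τ i * exp (-a i) ≤ 0`.
theorem IsDualSolution.multiplier_eq_zero {a b τ : A → ℝ} {w : A → A → ℝ}
    (h : IsDualSolution u z a b τ w) (hp : ∀ i, 0 < z.price i) (hβ : ∀ i, 0 < z.invBpb i) (i : A) :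
    τ i = 0 := by
  have hτ (i : A) : τ i * Real.exp (-a i) ≤
      ∑ j, w i j * (u i j)⁺ * Real.exp (b i) - ∑ k, w k i * Real.exp (-a i) := by
    have hx : 0 < z.price i / z.invBpb i := div_pos (hp i) (hβ i)
    have hlog := Real.log_le_sub_one_of_pos (mul_pos hx (Real.exp_pos (a i + b i)))
    rw [Real.log_mul hx.ne' (Real.exp_ne_zero _), Real.log_exp] at hlog
    rw [← Finset.sum_mul, ← Finset.sum_mul, ← h.invBpb]
    calc τ i * Real.exp (-a i)
        ≤ (z.price i / z.invBpb i * Real.exp (a i + b i) - ∑ k, w k i) * Real.exp (-a i) := by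
          gcongr
          linarith [h.price i]
      _ = _ := by
          rw [sub_mul, mul_assoc, ← Real.exp_add, add_neg_cancel_comm]
  have hw (i j : A) : w i j * (u i j)⁺ * Real.exp (b i) ≤ w i j * Real.exp (-a j) := by
    rw [mul_assoc]
    refine mul_le_mul_of_nonneg_left ?_ (h.bpb_nonneg i j)
    by_cases hij : Arc u i j
    · rw [posPart_of_nonneg hij.le, ← Real.exp_log hij, ← Real.exp_add, Real.exp_le_exp]
      linarith [h.pay i j hij]
    · rw [posPart_of_nonpos (not_lt.1 hij), zero_mul]
      positivity
  have hsum : ∑ i, τ i * Real.exp (-a i) ≤ 0 :=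
    calc ∑ i, τ i * Real.exp (-a i)
        ≤ ∑ i, (∑ j, w i j * (u i j)⁺ * Real.exp (b i) - ∑ k, w k i * Real.exp (-a i)) :=
          Finset.sum_le_sum fun i _ => hτ i
      _ = ∑ i, ∑ j, w i j * (u i j)⁺ * Real.exp (b i) - ∑ i, ∑ j, w i j * Real.exp (-a j) := by
          rw [Finset.sum_sub_distrib, Finset.sum_comm (f := fun i k => w k i * Real.exp (-a i))]
      _ ≤ 0 := sub_nonpos.2 (Finset.sum_le_sum fun i _ => Finset.sum_le_sum fun j _ => hw i j)
  have hnonneg (i : A) : 0 ≤ τ i * Real.exp (-a i) := mul_nonneg (h.price_nonneg i) (by positivity)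
  have hzero := (Finset.sum_eq_zero_iff_of_nonneg fun i _ => hnonneg i).1
    (hsum.antisymm (Finset.sum_nonneg fun i _ => hnonneg i)) i (Finset.mem_univ i)
  exact (mul_eq_zero.1 hzero).resolve_right (Real.exp_ne_zero _)

theorem realObjective_eq_zero_of_isLocalMinOn (h : IsFeasible u z) (hβ : ∀ i, 0 < z.invBpb i)
    (hmin : IsLocalMinOn (realObjective u) (feasibleSet u) z) : realObjective u z = 0 := by
  obtain ⟨a, b, τ, w, hdual⟩ := exists_isDualSolution h hβ hmin
  rw [hdual.realObjective_eq]
  exact Finset.sum_eq_zero fun i _ => hdual.multiplier_eq_zero h.price_pos hβ i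

end Duality

section Attainment

open Relation (ReflTransGen)

variable {A : Type*}

/-- The point `z` with all variables of agent `i` multiplied by `μ i`. -/
def Vars.scale (z : Vars A) (μ : A → ℝ) : Vars A :=
  (fun i j => μ i * z.pay i j, μ * z.price, μ * z.invBpb)

/-- From every node a node of price one can be reached. -/
def IsNormalized (u : A → A → ℝ) (z : Vars A) : Prop :=
  ∀ i, ∃ k, ReflTransGen (Arc u) i k ∧ z.price k = 1

variable [Fintype A] {u v : A → A → ℝ} {z : Vars A} {f₀ : ℝ} {μ : A → ℝ}

/-- The feasible points with positive `β` and objective value at most `f₀`. -/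
def sublevel (u : A → A → ℝ) (f₀ : ℝ) : Set (Vars A) :=
  {z | IsFeasible u z ∧ (∀ i, 0 < z.invBpb i) ∧ realObjective u z ≤ f₀}

-- The good on which agent `i` spends most takes a share `1 / n` of an income of at least `1`, so
-- its gap is at most `n * f₀`.
theorem exists_arc_price_le_of_mem_sublevel (hz : z ∈ sublevel u f₀) (i : A) :
    ∃ m, Arc u i m ∧ z.price i ≤ Fintype.card A * z.price m ∧
      z.price m ≤ Real.exp (Fintype.card A * f₀) * (u i m * z.invBpb i) := by
  obtain ⟨h, hβ, hf⟩ := hz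
  have hn : (0 : ℝ) < Fintype.card A := Nat.cast_pos.2 (Fintype.card_pos_iff.2 ⟨i⟩)
  obtain ⟨m, -, hm⟩ := Finset.exists_le_of_sum_le (s := Finset.univ)
    (f := fun _ => z.price i / Fintype.card A) (g := z.pay i) ⟨i, Finset.mem_univ i⟩ <| by
      rw [h.sum_outflow, Finset.sum_const, Finset.card_univ, nsmul_eq_mul,
        mul_div_cancel₀ _ hn.ne']
  rw [div_le_iff₀' hn] at hm
  have hpay : 0 < z.pay i m := pos_of_mul_pos_right ((h.price_pos i).trans_le hm) hn.le
  have harc := h.arc_of_pay_ne_zero hpay.ne'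
  refine ⟨m, harc, hm.trans (mul_le_mul_of_nonneg_left ?_ hn.le), ?_⟩
  · rw [← h.sum_inflow m]
    exact Finset.single_le_sum (f := fun k => z.pay k m) (fun k _ => h.zero_le_pay k m)
      (Finset.mem_univ i)
  · have hgap : logGap u z i m ≤ Fintype.card A * f₀ := by
      have hgap_nonneg := nonneg_of_mul_nonneg_right (pay_mul_logGap_nonneg h hβ i m) hpay
      calc logGap u z i m ≤ Fintype.card A * z.pay i m * logGap u z i m :=
            le_mul_of_one_le_left hgap_nonneg ((h.one_le_price i).trans hm)
        _ ≤ Fintype.card A * f₀ := by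
          rw [mul_assoc]
          gcongr
          exact (pay_mul_logGap_le_realObjective h hβ i m).trans hf
    rw [logGap_eq_log_sub_log harc (hβ i), sub_le_iff_le_add] at hgap
    have hub : 0 < u i m * z.invBpb i := mul_pos harc (hβ i)
    rwa [← Real.log_le_log_iff (h.price_pos m) (by positivity),
      Real.log_mul (Real.exp_ne_zero _) hub.ne', Real.log_exp]

theorem exists_pos_forall_le_invBpb (u : A → A → ℝ) (f₀ : ℝ) :
    ∃ δ > 0, ∀ z ∈ sublevel u f₀, ∀ i, δ ≤ z.invBpb i := by
  obtain ⟨c, hc, hu⟩ := exists_pos_forall_le u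
  refine ⟨(Real.exp (Fintype.card A * f₀) * c)⁻¹, by positivity, fun z hz i => ?_⟩
  obtain ⟨m, -, -, hm⟩ := exists_arc_price_le_of_mem_sublevel hz i
  rw [inv_le_iff_one_le_mul₀' (by positivity), mul_assoc]
  refine (hz.1.one_le_price m).trans (hm.trans ?_)
  gcongr
  exacts [(hz.2.1 i).le, hu i m]

theorem exists_price_le_mul_price_of_arc (f₀ : ℝ) {i j : A} (hij : Arc u i j) :
    ∃ C ≥ 0, ∀ z ∈ sublevel u f₀, z.price i ≤ C * z.price j := by
  obtain ⟨c, hc, hu⟩ := exists_pos_forall_le u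
  have hij0 : 0 < u i j := hij
  refine ⟨Fintype.card A * (Real.exp (Fintype.card A * f₀) * (c / u i j)), by positivity,
    fun z hz => ?_⟩
  obtain ⟨m, -, hpm, hm⟩ := exists_arc_price_le_of_mem_sublevel hz i
  calc z.price i ≤ Fintype.card A * z.price m := hpm
    _ ≤ Fintype.card A * (Real.exp (Fintype.card A * f₀) * (c * (z.price j / u i j))) := by
      refine mul_le_mul_of_nonneg_left (hm.trans ?_) (Nat.cast_nonneg _)
      gcongr
      · exact (hz.2.1 i).le
      · exact hu i m
      · exact (le_div_iff₀' hij0).2 (hz.1.bpb i j hij)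
    _ = _ := by ring

theorem exists_price_le_mul_price_of_reflTransGen (f₀ : ℝ) {i j : A}
    (hij : ReflTransGen (Arc u) i j) :
    ∃ C ≥ 0, ∀ z ∈ sublevel u f₀, z.price i ≤ C * z.price j := by
  induction hij with
  | refl => exact ⟨1, zero_le_one, fun z _ => (one_mul _).ge⟩
  | tail _ hkj ih =>
    obtain ⟨C, hC, hz⟩ := ih
    obtain ⟨C', hC', hz'⟩ := exists_price_le_mul_price_of_arc f₀ hkj
    refine ⟨C * C', mul_nonneg hC hC', fun z hmem => (hz z hmem).trans ?_⟩
    rw [mul_assoc]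
    exact mul_le_mul_of_nonneg_left (hz' z hmem) hC

theorem exists_price_le_of_isNormalized (u : A → A → ℝ) (f₀ : ℝ) :
    ∃ N, ∀ z ∈ sublevel u f₀, IsNormalized u z → ∀ i, z.price i ≤ N := by
  have hC (i k : A) : ∃ C : ℝ, ReflTransGen (Arc u) i k →
      ∀ z ∈ sublevel u f₀, z.price i ≤ C * z.price k := by
    by_cases hik : ReflTransGen (Arc u) i k
    · exact (exists_price_le_mul_price_of_reflTransGen f₀ hik).imp fun C hC _ => hC.2
    · exact ⟨0, fun h => absurd h hik⟩
  choose C hC using hC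
  obtain ⟨N, -, hN⟩ := exists_pos_forall_le C
  refine ⟨N, fun z hz hnorm i => ?_⟩
  obtain ⟨k, hik, hk⟩ := hnorm i
  calc z.price i ≤ C i k * z.price k := hC i k hik z hz
    _ ≤ N := by simpa [hk] using hN i k

theorem exists_isCompact_of_isNormalized (hout : ∀ i, ∃ j, Arc u i j) (f₀ : ℝ) :
    ∃ K, IsCompact K ∧ (∀ z ∈ K, IsFeasible u z ∧ ∀ i, 0 < z.invBpb i) ∧
      ∀ z ∈ sublevel u f₀, IsNormalized u z → z ∈ K := by
  obtain ⟨δ, hδ, hδz⟩ := exists_pos_forall_le_invBpb u f₀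
  obtain ⟨N, hN⟩ := exists_price_le_of_isNormalized u f₀
  choose m hm using hout
  refine ⟨feasibleSet u ∩ Set.Icc (0, 0, fun _ => δ) (fun _ _ => N, fun _ => N,
    fun i => N / u i (m i)), isCompact_Icc.inter_left isClosed_feasibleSet,
    fun z hz => ⟨hz.1, fun i => hδ.trans_le (hz.2.1.2.2 i)⟩, fun z hz hnorm => ⟨hz.1,
      ⟨hz.1.zero_le_pay, fun i => (hz.1.price_pos i).le, hδz z hz⟩, fun i j => ?_,
      hN z hz hnorm, fun i => ?_⟩⟩
  · calc z.pay i j ≤ ∑ j, z.pay i j :=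
        Finset.single_le_sum (fun j _ => hz.1.zero_le_pay i j) (Finset.mem_univ j)
      _ = z.price i := hz.1.sum_outflow i
      _ ≤ N := hN z hz hnorm i
  · exact (le_div_iff₀' (hm i)).2 ((hz.1.bpb i (m i) (hm i)).trans (hN z hz hnorm (m i)))

theorem IsFeasible.scale (h : IsFeasible v z) (hμ : ∀ i, 0 ≤ μ i)
    (hpay : ∀ i j, z.pay i j ≠ 0 → Arc u i j ∧ μ i = μ j)
    (hbpb : ∀ i j, Arc u i j → u i j * (μ i * z.invBpb i) ≤ μ j * z.price j)
    (hprice : ∀ i, 1 ≤ μ i * z.price i) : IsFeasible u (z.scale μ) := by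
  have hcongr (i j : A) : μ i * z.pay i j = μ j * z.pay i j := by
    by_cases hij : z.pay i j = 0
    · rw [hij, mul_zero, mul_zero]
    · rw [(hpay i j hij).2]
  refine .of_sums (fun j => ?_) (fun i => ?_) hbpb hprice
    (fun i j => mul_nonneg (hμ i) (h.zero_le_pay i j))
    (fun i => mul_nonneg (hμ i) (h.invBpb_nonneg i)) fun i j hij => ?_
  · change ∑ i, μ i * z.pay i j = μ j * z.price j
    simp only [hcongr _ j, ← Finset.mul_sum, h.sum_inflow]
  · change ∑ j, μ i * z.pay i j = μ i * z.price i
    rw [← Finset.mul_sum, h.sum_outflow]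
  · exact mul_eq_zero_of_right _ (not_imp_comm.1 (fun hne => (hpay i j hne).1) hij)

theorem IsFeasible.realObjective_scale_le (h : IsFeasible u z) (hβ : ∀ i, 0 < z.invBpb i)
    (hμ : ∀ i, 0 < μ i) (hμ1 : ∀ i, μ i ≤ 1) (hpay : ∀ i j, Arc u i j → μ i = μ j)
    (hscale : IsFeasible u (z.scale μ)) :
    realObjective u (z.scale μ) ≤ realObjective u z := by
  have hβ' (i : A) : 0 < (z.scale μ).invBpb i := mul_pos (hμ i) (hβ i)
  rw [realObjective_eq_sum_pay_mul_logGap hscale hβ', realObjective_eq_sum_pay_mul_logGap h hβ]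
  refine Finset.sum_le_sum fun i _ => Finset.sum_le_sum fun j _ => ?_
  by_cases hij : Arc u i j
  · have hgap : logGap u (z.scale μ) i j = logGap u z i j := by
      have hlog : Real.log (μ j * z.price j) - Real.log (u i j * (μ i * z.invBpb i)) =
          Real.log (z.price j) - Real.log (u i j * z.invBpb i) := by
        rw [mul_left_comm, hpay i j hij, Real.log_mul (hμ j).ne' (h.price_pos j).ne',
          Real.log_mul (hμ j).ne' (mul_pos hij (hβ i)).ne', add_sub_add_left_eq_sub]
      rwa [logGap_eq_log_sub_log hij (hβ' i), logGap_eq_log_sub_log hij (hβ i)]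
    rw [hgap]
    calc μ i * z.pay i j * logGap u z i j = μ i * (z.pay i j * logGap u z i j) := mul_assoc ..
      _ ≤ z.pay i j * logGap u z i j :=
        mul_le_of_le_one_left (pay_mul_logGap_nonneg h hβ i j) (hμ1 i)
  · rw [h.pay_arc i j hij, hscale.pay_arc i j hij, zero_mul, zero_mul]

theorem exists_isNormalized (hsymm : ∀ i j, Arc u i j → ReflTransGen (Arc u) j i)
    (hz : z ∈ sublevel u f₀) : ∃ w ∈ sublevel u f₀, IsNormalized u w ∧
      realObjective u w ≤ realObjective u z := by
  obtain ⟨h, hβ, hf⟩ := hz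
  have hmin (i : A) : ∃ k, ReflTransGen (Arc u) i k ∧
      ∀ l, ReflTransGen (Arc u) i l → z.price k ≤ z.price l :=
    Set.exists_min_image {k | ReflTransGen (Arc u) i k} z.price (Set.toFinite _) ⟨i, .refl⟩
  choose κ hκ hκmin using hmin
  have harc (i j : A) (hij : Arc u i j) : z.price (κ i) = z.price (κ j) :=
    le_antisymm (hκmin i _ ((hκ j).head hij)) (hκmin j _ ((hsymm i j hij).trans (hκ i)))
  have hwalk (i k : A) (hik : ReflTransGen (Arc u) i k) : z.price (κ i) = z.price (κ k) := by
    induction hik with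
    | refl => rfl
    | tail _ hjk ih => exact ih.trans (harc _ _ hjk)
  have hμ (i : A) : 0 < (z.price (κ i))⁻¹ := inv_pos.2 (h.price_pos _)
  have hμarc (i j : A) (hij : Arc u i j) : (z.price (κ i))⁻¹ = (z.price (κ j))⁻¹ := by
    rw [harc i j hij]
  have hscale : IsFeasible u (z.scale fun i => (z.price (κ i))⁻¹) := by
    refine h.scale (fun i => (hμ i).le) (fun i j hij => ⟨h.arc_of_pay_ne_zero hij,
      hμarc i j (h.arc_of_pay_ne_zero hij)⟩) (fun i j hij => ?_) fun i => ?_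
    · rw [mul_left_comm, hμarc i j hij]
      exact mul_le_mul_of_nonneg_left (h.bpb i j hij) (hμ j).le
    · rw [← div_eq_inv_mul, one_le_div (h.price_pos _)]
      exact hκmin i i .refl
  have hle := h.realObjective_scale_le hβ hμ (fun i => inv_le_one_of_one_le₀ (h.one_le_price _))
    hμarc hscale
  refine ⟨_, ⟨hscale, fun i => mul_pos (hμ i) (hβ i), hle.trans hf⟩, fun i => ⟨κ i, hκ i, ?_⟩, hle⟩
  change (z.price (κ (κ i)))⁻¹ * z.price (κ i) = 1
  rw [← hwalk i (κ i) (hκ i), inv_mul_cancel₀ (h.price_pos _).ne']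

theorem exists_minimizer_of_symm (h : SingletonComponentsHaveLoops u)
    (hsymm : ∀ i j, Arc u i j → ReflTransGen (Arc u) j i) :
    ∃ z, IsFeasible u z ∧ (∀ i, 0 < z.invBpb i) ∧
      ∀ w, IsFeasible u w → (∀ i, 0 < w.invBpb i) → realObjective u z ≤ realObjective u w := by
  obtain ⟨z₀, hz₀, hβ₀⟩ := h.exists_isFeasible
  have hmem : z₀ ∈ sublevel u (realObjective u z₀) := ⟨hz₀, hβ₀, le_rfl⟩
  obtain ⟨K, hK, hKfeas, hKmem⟩ := exists_isCompact_of_isNormalized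
    (fun i => (singletonComponentsHaveLoops_iff.1 h i).imp fun _ => And.left) (realObjective u z₀)
  have hnorm (w : Vars A) (hw : w ∈ sublevel u (realObjective u z₀)) :
      ∃ w' ∈ K, realObjective u w' ≤ realObjective u w :=
    let ⟨w', hw', hn, hle⟩ := exists_isNormalized hsymm hw
    ⟨w', hKmem w' hw' hn, hle⟩
  obtain ⟨w₀, hw₀, hle₀⟩ := hnorm z₀ hmem
  obtain ⟨z, hzK, hmin⟩ := hK.exists_isMinOn ⟨w₀, hw₀⟩ fun w hw =>
    (hasFDerivAt_realObjective (u := u) (hKfeas w hw).1.price_pos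
      (hKfeas w hw).2).continuousAt.continuousWithinAt
  refine ⟨z, (hKfeas z hzK).1, (hKfeas z hzK).2, fun w hw hβ => ?_⟩
  rcases le_total (realObjective u w) (realObjective u z₀) with hle | hle
  · obtain ⟨w', hw', hle'⟩ := hnorm w ⟨hw, hβ, hle⟩
    exact (hmin hw').trans hle'
  · exact (hmin hw₀).trans (hle₀.trans hle)

theorem exists_realObjective_eq_zero_of_symm (h : SingletonComponentsHaveLoops u)
    (hsymm : ∀ i j, Arc u i j → ReflTransGen (Arc u) j i) :
    ∃ z, IsFeasible u z ∧ (∀ i, 0 < z.invBpb i) ∧ realObjective u z = 0 := by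
  obtain ⟨z, hz, hβ, hmin⟩ := exists_minimizer_of_symm h hsymm
  refine ⟨z, hz, hβ, realObjective_eq_zero_of_isLocalMinOn hz hβ ?_⟩
  have hpos : ∀ᶠ w : Vars A in nhds z, ∀ i, 0 < w.invBpb i :=
    Filter.eventually_all.2 fun i =>
      continuousAt_const.eventually_lt (by fun_prop) (hβ i)
  filter_upwards [hpos.filter_mono nhdsWithin_le_nhds, self_mem_nhdsWithin] with w hβw hw
  exact hmin w hw hβw

end Attainment

section Gluing

open Relation (ReflTransGen)

variable {A : Type*} {u : A → A → ℝ} {i j : A}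

/-- The market in which only the arcs within strongly connected components are kept. -/
noncomputable def intraPart (u : A → A → ℝ) (i j : A) : ℝ :=
  open Classical in if ReflTransGen (Arc u) j i then u i j else 0

theorem arc_intraPart_iff : Arc (intraPart u) i j ↔ Arc u i j ∧ ReflTransGen (Arc u) j i := by
  unfold Arc intraPart
  split_ifs with h
  · exact (and_iff_left h).symm
  · exact iff_of_false (lt_irrefl _) fun hij => h hij.2

theorem reflTransGen_intraPart (hij : ReflTransGen (Arc u) i j) (hji : ReflTransGen (Arc u) j i) :
    ReflTransGen (Arc (intraPart u)) i j := by
  induction hij using ReflTransGen.head_induction_on with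
  | refl => exact .refl
  | head hik hkj ih => exact (ih (hji.tail hik)).head (arc_intraPart_iff.2 ⟨hik, hkj.trans hji⟩)

theorem reflTransGen_intraPart_of_arc (hij : Arc (intraPart u) i j) :
    ReflTransGen (Arc (intraPart u)) j i :=
  have ⟨hu, hji⟩ := arc_intraPart_iff.1 hij
  reflTransGen_intraPart hji (.single hu)

theorem singletonComponentsHaveLoops_intraPart (h : SingletonComponentsHaveLoops u) :
    SingletonComponentsHaveLoops (intraPart u) :=
  singletonComponentsHaveLoops_iff.2 fun i =>
    let ⟨j, hij, hji⟩ := singletonComponentsHaveLoops_iff.1 h i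
    have harc := arc_intraPart_iff.2 ⟨hij, hji⟩
    ⟨j, harc, reflTransGen_intraPart_of_arc harc⟩

/-- The number of nodes from which `i` can be reached. -/
noncomputable def ancestorCount (u : A → A → ℝ) (i : A) : ℕ :=
  {k | ReflTransGen (Arc u) k i}.ncard

theorem ancestorCount_eq_of_arc_intraPart (h : Arc (intraPart u) i j) :
    ancestorCount u i = ancestorCount u j := by
  obtain ⟨hij, hji⟩ := arc_intraPart_iff.1 h
  exact congrArg Set.ncard (Set.ext fun k => ⟨fun hk => hk.tail hij, fun hk => hk.trans hji⟩)

theorem ancestorCount_lt_of_arc [Finite A] (hij : Arc u i j) (hji : ¬ReflTransGen (Arc u) j i) :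
    ancestorCount u i < ancestorCount u j :=
  Set.ncard_lt_ncard ⟨fun _ hk => hk.tail hij, fun hsub => hji (hsub .refl)⟩ (Set.toFinite _)

variable [Fintype A]

-- The components are solved separately. Scaling them by powers of a large `L`, increasing along the
-- arcs between components, makes the bang-per-buck constraints of these arcs hold.
theorem SingletonComponentsHaveLoops.exists_objective_nonpos (h : SingletonComponentsHaveLoops u) :
    ∃ z, IsFeasible u z ∧ objective u z ≤ 0 := by
  obtain ⟨z, hz, hβ, h0⟩ := exists_realObjective_eq_zero_of_symm
    (singletonComponentsHaveLoops_intraPart h) fun _ _ => reflTransGen_intraPart_of_arc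
  rw [realObjective_eq_zero_iff hz hβ] at h0
  obtain ⟨L, hL, huL⟩ : ∃ L ≥ 1, ∀ i j, u i j * z.invBpb i ≤ L := by
    obtain ⟨c, -, hc⟩ := exists_pos_forall_le fun i j => u i j * z.invBpb i
    exact ⟨max c 1, le_max_right _ _, fun i j => le_max_of_le_left (hc i j)⟩
  have hμ1 (i : A) : 1 ≤ L ^ ancestorCount u i := one_le_pow₀ hL
  have hμ (i : A) : 0 < L ^ ancestorCount u i := one_pos.trans_le (hμ1 i)
  have hintra {i j : A} (hij : Arc (intraPart u) i j) :
      intraPart u i j = u i j := if_pos (arc_intraPart_iff.1 hij).2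
  have hμarc {i j : A} (hij : Arc (intraPart u) i j) :
      L ^ ancestorCount u i = L ^ ancestorCount u j := by rw [ancestorCount_eq_of_arc_intraPart hij]
  have hscale : IsFeasible u (z.scale fun i => L ^ ancestorCount u i) := by
    refine hz.scale (fun i => (hμ i).le) (fun i j hij => ?_) (fun i j hij => ?_)
      fun i => one_le_mul_of_one_le_of_one_le (hμ1 i) (hz.one_le_price i)
    · have harc := hz.arc_of_pay_ne_zero hij
      exact ⟨(arc_intraPart_iff.1 harc).1, hμarc harc⟩
    rw [mul_left_comm]
    by_cases hji : ReflTransGen (Arc u) j i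
    · have harc := arc_intraPart_iff.2 ⟨hij, hji⟩
      rw [hμarc harc, ← hintra harc]
      exact mul_le_mul_of_nonneg_left (hz.bpb i j harc) (hμ j).le
    · calc L ^ ancestorCount u i * (u i j * z.invBpb i) ≤ L ^ ancestorCount u i * L :=
            mul_le_mul_of_nonneg_left (huL i j) (hμ i).le
        _ ≤ L ^ ancestorCount u j := by
          rw [← pow_succ]
          exact pow_le_pow_right₀ hL (ancestorCount_lt_of_arc hij hji)
        _ ≤ L ^ ancestorCount u j * z.price j :=
          le_mul_of_one_le_right (hμ j).le (hz.one_le_price j)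
  refine ⟨_, hscale, (objective_nonpos_iff hscale).2
    ⟨fun i => mul_pos (hμ i) (hβ i), fun i j hij => ?_⟩⟩
  have hpay : z.pay i j ≠ 0 := right_ne_zero_of_mul hij
  have harc := hz.arc_of_pay_ne_zero hpay
  calc u i j * (L ^ ancestorCount u i * z.invBpb i)
      = L ^ ancestorCount u j * (intraPart u i j * z.invBpb i) := by
        rw [mul_left_comm, hμarc harc, hintra harc]
    _ = L ^ ancestorCount u j * z.price j := by rw [h0 i j hpay]

theorem isOptimal_iff (h : SingletonComponentsHaveLoops u) {z : Vars A} :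
    IsOptimal u z ↔ IsFeasible u z ∧ objective u z ≤ 0 := by
  refine ⟨fun ⟨hz, hmin⟩ => ⟨hz, ?_⟩, fun ⟨hz, hz0⟩ => ⟨hz, fun w hw => ?_⟩⟩
  · obtain ⟨w, hw, hw0⟩ := h.exists_objective_nonpos
    exact (hmin w hw).trans hw0
  · exact hz0.trans (objective_nonneg hw)

theorem isLeast_objective (h : SingletonComponentsHaveLoops u) :
    IsLeast (objective u '' feasibleSet u) 0 := by
  obtain ⟨z, hz, hz0⟩ := h.exists_objective_nonpos
  exact ⟨⟨z, hz, hz0.antisymm (objective_nonneg hz)⟩,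
    Set.forall_mem_image.2 fun _ => objective_nonneg⟩

end Gluing

section Bitsize

open scoped Nat

theorem natAbs_num_le_two_pow_bitsize (q : ℚ) : q.num.natAbs ≤ 2 ^ bitsize q :=
  (Nat.le_pow_clog one_lt_two _).trans (Nat.pow_le_pow_right two_pos (Nat.le_add_right _ _))

theorem den_le_two_pow_bitsize (q : ℚ) : q.den ≤ 2 ^ bitsize q :=
  (Nat.le_pow_clog one_lt_two _).trans (Nat.pow_le_pow_right two_pos (Nat.le_add_left _ _))

theorem bitsize_div_le {a b : ℤ} {e : ℕ} (ha : a.natAbs ≤ 2 ^ e) (hb : b.natAbs ≤ 2 ^ e) :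
    bitsize ((a : ℚ) / b) ≤ 2 * e := by
  rcases eq_or_ne a 0 with rfl | ha0
  · simp [bitsize]
  rcases eq_or_ne b 0 with rfl | hb0
  · simp [bitsize]
  rw [← Rat.divInt_eq_div, bitsize, two_mul]
  exact Nat.add_le_add
    (Nat.clog_le_of_le_pow <| (Nat.le_of_dvd (Int.natAbs_pos.2 ha0)
      (Int.natAbs_dvd_natAbs.2 (Rat.num_dvd a hb0))).trans ha)
    (Nat.clog_le_of_le_pow <| (Nat.le_of_dvd (Int.natAbs_pos.2 hb0)
      (Int.natCast_dvd.1 (Rat.den_dvd a b))).trans hb)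

theorem factorial_mul_pow_le_two_pow (m r l : ℕ) :
    m ! * (r * (2 ^ l) ^ 2) ^ m ≤ 2 ^ (m * (m + r + 2 * l)) :=
  calc m ! * (r * (2 ^ l) ^ 2) ^ m ≤ (2 ^ m) ^ m * (2 ^ r * (2 ^ l) ^ 2) ^ m :=
        Nat.mul_le_mul
          ((Nat.factorial_le_pow m).trans (Nat.pow_le_pow_left Nat.lt_two_pow_self.le m))
          (Nat.pow_le_pow_left (Nat.mul_le_mul_right _ Nat.lt_two_pow_self.le) m)
    _ = 2 ^ (m * (m + r + 2 * l)) := by ring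

variable {A : Type*} [Fintype A]

theorem card_le_inputSize (u : A → A → ℚ) : Fintype.card A ≤ inputSize u := Nat.le_add_right _ _

theorem bitsize_posPart_le_inputSize (u : A → A → ℚ) (i j : A) :
    bitsize (u i j)⁺ ≤ inputSize u := by
  rcases le_or_gt (u i j) 0 with hij | hij
  · simp [posPart_of_nonpos hij, bitsize]
  · rw [posPart_of_nonneg hij.le]
    calc bitsize (u i j) ≤ 1 + bitsize (u i j) := Nat.le_add_left _ _
      _ ≤ ∑ j with 0 < u i j, (1 + bitsize (u i j)) :=
        Finset.single_le_sum_of_canonicallyOrdered (f := fun j => 1 + bitsize (u i j))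
          ((Finset.mem_filter_univ j).2 hij)
      _ ≤ ∑ i, ∑ j with 0 < u i j, (1 + bitsize (u i j)) :=
        Finset.single_le_sum_of_canonicallyOrdered
          (f := fun i => ∑ j with 0 < u i j, (1 + bitsize (u i j))) (Finset.mem_univ i)
      _ ≤ inputSize u := Nat.le_add_left _ _

theorem outputSize_le {p : A → ℚ} {x : A → A → ℚ} {e : ℕ} (hp : ∀ i, bitsize (p i) ≤ e)
    (hx : ∀ i j, bitsize (x i j) ≤ e) :
    outputSize p x ≤ (Fintype.card A + Fintype.card A ^ 2) * e :=
  calc outputSize p x ≤ ∑ _i : A, e + ∑ _i : A, ∑ _j : A, e :=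
        Nat.add_le_add (Finset.sum_le_sum fun i _ => hp i)
          (Finset.sum_le_sum fun i _ => Finset.sum_le_sum fun j _ => hx i j)
    _ = (Fintype.card A + Fintype.card A ^ 2) * e := by
        simp only [Finset.sum_const, Finset.card_univ, smul_eq_mul]
        ring

end Bitsize

section RationalVertex

open scoped Nat Matrix

variable {A : Type*}

theorem abs_rowBound_le (r : Row A) : |rowBound ℤ r| ≤ 1 := by
  rcases r with (_ | _ | _) | _ | _ | _ <;> simp [rowBound]

theorem map_rowBound {K L : Type*} [CommRing K] [CommRing L] (f : K →+* L) (r : Row A) :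
    f (rowBound K r) = rowBound L r := by
  rcases r with (_ | _ | _) | _ | _ | _ <;> simp [rowBound]

theorem num_posPart_eq_den_mul_posPart (u : A → A → ℚ) :
    (fun i j => ((u i j)⁺.num : ℝ)) =
      (fun i j => ((u i j)⁺.den : ℝ)) * (fun i j => (u i j : ℝ))⁺ := by
  ext i j
  have hcast : (u i j : ℝ)⁺ = ((u i j)⁺ : ℚ) := by simp [posPart_def]
  calc ((u i j)⁺.num : ℝ) = (u i j)⁺.den * ((u i j)⁺ : ℚ) := by
        exact_mod_cast (Rat.den_mul_eq_num (u i j)⁺).symm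
    _ = (u i j)⁺.den * (u i j : ℝ)⁺ := by rw [hcast]

variable [Fintype A]

theorem exists_optimal_vertex {u s t : A → A → ℝ} (h : SingletonComponentsHaveLoops u)
    (hs : ∀ i j, 0 < s i j) (ht : t = s * u⁺) :
    ∃ z ∈ (feasibleSet u).extremePoints ℝ, objective u z ≤ 0 ∧
      ∀ d, (∀ r, row s t r (coords z) = rowBound ℝ r → row s t r d = 0) → d = 0 := by
  obtain ⟨z₀, hz₀, h0⟩ := h.exists_objective_nonpos
  obtain ⟨-, hgap⟩ := (objective_nonpos_iff hz₀).1 h0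
  have hpoly := feasibleSet_eq_polyhedron hs ht
  obtain ⟨z, hz, htight, hker⟩ := exists_vertex_of_mem_polyhedron
    (fun d hd => coords.map_eq_zero_iff.1 (funext fun k => hd (Row.coord k))) (hpoly.subset hz₀)
  have hzf : IsFeasible u z := hpoly.superset hz
  have hbest (i j : A) (hij : z.pay i j ≠ 0) : u i j * z.invBpb i = z.price j := by
    have hij₀ : z₀.pay i j ≠ 0 := fun hn => hij (htight (.coord (.pay i j)) hn)
    have hbpb (w : Vars A) : row s t (.bpb i j) (coords w) =
        s i j * (w.price j - u i j * w.invBpb i) := by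
      simp [row, coords, ht, posPart_of_nonneg (hz₀.arc_of_pay_ne_zero hij₀).le]
      ring
    have htight_bpb : row s t (.bpb i j) (coords z) = 0 := htight (.bpb i j) <| by
      change row s t (.bpb i j) (coords z₀) = 0
      rw [hbpb, hgap i j hij₀, sub_self, mul_zero]
    rw [hbpb, mul_eq_zero_iff_left (hs i j).ne', sub_eq_zero] at htight_bpb
    exact htight_bpb.symm
  refine ⟨z, hpoly ▸ mem_extremePoints_polyhedron hz hker,
    (objective_nonpos_iff hzf).2 ⟨fun i => ?_, hbest⟩, fun d hd => ?_⟩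
  · obtain ⟨j, -, hij⟩ := Finset.exists_ne_zero_of_sum_ne_zero
      ((hzf.sum_outflow i).trans_ne (hzf.price_pos i).ne')
    refine (hzf.invBpb_nonneg i).lt_of_ne fun hn => (hzf.price_pos j).ne ?_
    rw [← hbest i j hij, ← hn, mul_zero]
  · refine coords.symm.map_eq_zero_iff.1 (hker _ fun r hr => ?_)
    simpa using hd r hr

theorem abs_row_single_le [DecidableEq (Coord A)] {s t : A → A → ℤ} {B : ℕ} (hB : 1 ≤ B)
    (hs : ∀ i j, |s i j| ≤ B) (ht : ∀ i j, |t i j| ≤ B) (r : Row A) (k : Coord A) :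
    |row s t r (Pi.single k 1)| ≤ B := by
  classical
  have hB' : (1 : ℤ) ≤ B := mod_cast hB
  have hite {P : Prop} [Decidable P] {a : ℤ} (ha : |a| ≤ B) : |if P then a else 0| ≤ B := by
    split_ifs <;> simp [ha]
  rcases r with l | j | i | ⟨i, j⟩ <;> rcases k with ⟨a, b⟩ | a | a <;>
    simp [row, Pi.single_apply, ite_and, hite, hB', hs, ht]

theorem map_row {K L : Type*} [CommRing K] [CommRing L] (f : K →+* L) (s t : A → A → K) (r : Row A)
    (x : Coord A → K) :
    f (row s t r x) = row (fun i j => f (s i j)) (fun i j => f (t i j)) r (f ∘ x) := by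
  cases r <;> simp [row]

theorem exists_int_fractions_of_tight {s t : A → A → ℤ} {B : ℕ} (hB : 1 ≤ B)
    (hs : ∀ i j, |s i j| ≤ B) (ht : ∀ i j, |t i j| ≤ B) {x : Coord A → ℝ}
    (hker : ∀ d, (∀ r, row (fun i j => (s i j : ℝ)) (fun i j => (t i j : ℝ)) r x = rowBound ℝ r →
      row (fun i j => (s i j : ℝ)) (fun i j => (t i j : ℝ)) r d = 0) → d = 0) :
    ∃ (D : ℤ) (N : Coord A → ℤ), D ≠ 0 ∧ (∀ k, x k = N k / D) ∧
      D.natAbs ≤ (Fintype.card (Coord A))! *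
        (Fintype.card (Row A) * B ^ 2) ^ Fintype.card (Coord A) ∧
      ∀ k, (N k).natAbs ≤ (Fintype.card (Coord A))! *
        (Fintype.card (Row A) * B ^ 2) ^ Fintype.card (Coord A) := by
  classical
  let L := row (fun i j => (s i j : ℝ)) (fun i j => (t i j : ℝ))
  let Tight := {r // L r x = rowBound ℝ r}
  let M : Matrix Tight (Coord A) ℤ := fun r k => row s t r (Pi.single k 1)
  have hM (d : Coord A → ℝ) (r : Tight) : (M.map (Int.castRingHom ℝ) *ᵥ d) r = L r d := by
    have hsingle (k : Coord A) :
        (M.map (Int.castRingHom ℝ)) r k = L r fun l => if k = l then 1 else 0 := by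
      refine (map_row (Int.castRingHom ℝ) s t r (Pi.single k 1)).trans (congrArg (L r) ?_)
      ext l
      simp [Pi.single_apply, eq_comm]
    rw [LinearMap.pi_apply_eq_sum_univ]
    exact Finset.sum_congr rfl fun k _ => (congrArg (· * d k) (hsingle k)).trans (mul_comm _ _)
  obtain ⟨D, N, hD, hN, hDle, hNle⟩ := exists_int_fractions_of_unique_solution
    (fun r k => abs_row_single_le hB hs ht r.1 k)
    (c := fun r : Tight => rowBound ℤ r.1)
    (fun r => (abs_rowBound_le r.1).trans (mod_cast hB))
    (funext fun r => ((hM x r).trans r.2).trans (map_rowBound _ _).symm)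
    fun d hd => hker d fun r hr => (hM d ⟨r, hr⟩).symm.trans (congrFun hd ⟨r, hr⟩)
  have hcard : Fintype.card Tight ≤ Fintype.card (Row A) := Fintype.card_subtype_le _
  refine ⟨D, N, hD, hN, hDle.trans ?_, fun k => (hNle k).trans ?_⟩ <;> gcongr

/-- The vertex is rational because, after clearing denominators in the bang-per-buck rows, its tight
constraints form an integral linear system. -/
theorem exists_optimal_int_fractions {u : A → A → ℚ}
    (h : SingletonComponentsHaveLoops fun i j => (u i j : ℝ)) :
    ∃ z ∈ (feasibleSet fun i j => (u i j : ℝ)).extremePoints ℝ,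
      objective (fun i j => (u i j : ℝ)) z ≤ 0 ∧
      ∃ (D : ℤ) (N : Coord A → ℤ), D ≠ 0 ∧ (∀ k, coords z k = N k / D) ∧
        D.natAbs ≤ 2 ^ (Fintype.card (Coord A) *
          (Fintype.card (Coord A) + Fintype.card (Row A) + 2 * inputSize u)) ∧
        ∀ k, (N k).natAbs ≤ 2 ^ (Fintype.card (Coord A) *
          (Fintype.card (Coord A) + Fintype.card (Row A) + 2 * inputSize u)) := by
  obtain ⟨z, hz, hz0, hker⟩ := exists_optimal_vertex h
    (fun i j => Nat.cast_pos.2 (u i j)⁺.den_pos) (num_posPart_eq_den_mul_posPart u)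
  have hle {q : ℚ} (hq : bitsize q ≤ inputSize u) : 2 ^ bitsize q ≤ 2 ^ inputSize u :=
    Nat.pow_le_pow_right two_pos hq
  obtain ⟨D, N, hD, hN, hDle, hNle⟩ := exists_int_fractions_of_tight
    (s := fun i j => ((u i j)⁺.den : ℤ)) (t := fun i j => (u i j)⁺.num) (x := coords z)
    (Nat.one_le_two_pow (n := inputSize u))
    (fun i j => by
      rw [Nat.abs_cast]
      exact_mod_cast (den_le_two_pow_bitsize _).trans (hle (bitsize_posPart_le_inputSize u i j)))
    (fun i j => by
      rw [Int.abs_eq_natAbs]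
      exact_mod_cast
        (natAbs_num_le_two_pow_bitsize _).trans (hle (bitsize_posPart_le_inputSize u i j)))
    (mod_cast hker)
  exact ⟨z, hz, hz0, D, N, hD, hN, hDle.trans (factorial_mul_pow_le_two_pow _ _ _),
    fun k => (hNle k).trans (factorial_mul_pow_le_two_pow _ _ _)⟩

/-- The polynomial that bounds the encoding length of the equilibrium: `X + X²` numbers, whose
numerators and denominators have the logarithm given by `exists_optimal_int_fractions`. -/
noncomputable def sizeBound : Polynomial ℕ :=
  (.X + .X ^ 2) * (2 * ((.X ^ 2 + 2 * .X) * (3 * .X ^ 2 + 8 * .X)))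

theorem le_eval_sizeBound (u : A → A → ℚ) :
    (Fintype.card A + Fintype.card A ^ 2) * (2 * (Fintype.card (Coord A) *
      (Fintype.card (Coord A) + Fintype.card (Row A) + 2 * inputSize u))) ≤
      sizeBound.eval (inputSize u) := by
  have hn := card_le_inputSize u
  rw [card_coord, card_row]
  calc _ ≤ (inputSize u + inputSize u ^ 2) * (2 * ((inputSize u ^ 2 + 2 * inputSize u) *
        (inputSize u ^ 2 + 2 * inputSize u + (2 * inputSize u ^ 2 + 4 * inputSize u) +
          2 * inputSize u))) := by gcongr
    _ = _ := by
      simp only [sizeBound, Polynomial.eval_mul, Polynomial.eval_add, Polynomial.eval_pow,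
        Polynomial.eval_X, Polynomial.eval_ofNat]
      ring

theorem exists_rational_equilibrium {u : A → A → ℚ}
    (h : SingletonComponentsHaveLoops fun i j => (u i j : ℝ)) :
    ∃ (y : A → A → ℚ) (p β : A → ℚ),
      ((fun i j => (y i j : ℝ), fun i => (p i : ℝ), fun i => (β i : ℝ)) : Vars A) ∈
        (feasibleSet fun i j => (u i j : ℝ)).extremePoints ℝ ∧
      IsOptimal (fun i j => (u i j : ℝ))
        (fun i j => (y i j : ℝ), fun i => (p i : ℝ), fun i => (β i : ℝ)) ∧
      IsEquilibrium (fun i j => (u i j : ℝ)) (fun i => (p i : ℝ))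
        (fun i j => ((y i j / p j : ℚ) : ℝ)) ∧
      outputSize p (fun i j => y i j / p j) ≤ sizeBound.eval (inputSize u) := by
  obtain ⟨z, hz, hz0, D, N, hD, hN, hDle, hNle⟩ := exists_optimal_int_fractions h
  have hpay (i j : A) : ((N (.pay i j) / D : ℚ) : ℝ) = z.pay i j := by
    push_cast
    exact (hN (.pay i j)).symm
  have hprice (i : A) : ((N (.price i) / D : ℚ) : ℝ) = z.price i := by
    push_cast
    exact (hN (.price i)).symm
  have hinvBpb (i : A) : ((N (.invBpb i) / D : ℚ) : ℝ) = z.invBpb i := by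
    push_cast
    exact (hN (.invBpb i)).symm
  refine ⟨fun i j => N (.pay i j) / D, fun i => N (.price i) / D, fun i => N (.invBpb i) / D,
    ?_, ?_, ?_, ?_⟩
  · simpa only [hpay, hprice, hinvBpb] using hz
  · simpa only [hpay, hprice, hinvBpb] using (isOptimal_iff h).2 ⟨hz.1, hz0⟩
  · simpa only [Rat.cast_div (N (.pay _ _) / D : ℚ), hpay, hprice] using
      isEquilibrium_of_objective_nonpos hz.1 hz0
  · have hx (i j : A) : (N (.pay i j) / D : ℚ) / (N (.price j) / D) = N (.pay i j) / N (.price j) :=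
      div_div_div_cancel_right₀ (Int.cast_ne_zero.2 hD) _ _
    simp only [hx]
    exact (outputSize_le (fun i => bitsize_div_le (hNle _) hDle)
      fun i j => bitsize_div_le (hNle _) (hNle _)).trans (le_eval_sizeBound u)

end RationalVertex

end ArrowDebreu

theorem theorem1_general :
    (∀ (A : Type*) [Fintype A] (u : A → A → ℝ),
      ArrowDebreu.IsConvexProgram u ∧
      ((ArrowDebreu.feasibleSet u).Nonempty ↔ ArrowDebreu.SingletonComponentsHaveLoops u) ∧
      (ArrowDebreu.SingletonComponentsHaveLoops u →
        IsLeast (ArrowDebreu.objective u '' ArrowDebreu.feasibleSet u) 0 ∧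
        ∀ z : ArrowDebreu.Vars A, ArrowDebreu.IsOptimal u z →
          ArrowDebreu.IsEquilibrium u z.price (fun i j => z.pay i j / z.price j))) ∧
    (∃ P : Polynomial ℕ, ∀ (A : Type*) [Fintype A] (u : A → A → ℚ),
      ArrowDebreu.SingletonComponentsHaveLoops (fun i j => (u i j : ℝ)) →
      ∃ (y : A → A → ℚ) (p β : A → ℚ),
        ((fun i j => (y i j : ℝ), fun i => (p i : ℝ), fun i => (β i : ℝ)) : ArrowDebreu.Vars A) ∈
          (ArrowDebreu.feasibleSet (fun i j => (u i j : ℝ))).extremePoints ℝ ∧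
        ArrowDebreu.IsOptimal (fun i j => (u i j : ℝ))
          (fun i j => (y i j : ℝ), fun i => (p i : ℝ), fun i => (β i : ℝ)) ∧
        ArrowDebreu.IsEquilibrium (fun i j => (u i j : ℝ)) (fun i => (p i : ℝ))
          (fun i j => ((y i j / p j : ℚ) : ℝ)) ∧
        ArrowDebreu.outputSize p (fun i j => y i j / p j) ≤ P.eval (ArrowDebreu.inputSize u)) :=
  ⟨fun _ _ _ => ⟨ArrowDebreu.isConvexProgram, ArrowDebreu.nonempty_feasibleSet_iff, fun h =>
    ⟨ArrowDebreu.isLeast_objective h, fun _ hz =>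
      let ⟨hfeas, hz0⟩ := (ArrowDebreu.isOptimal_iff h).1 hz
      ArrowDebreu.isEquilibrium_of_objective_nonpos hfeas hz0⟩⟩,
    ArrowDebreu.sizeBound, fun _ _ _ => ArrowDebreu.exists_rational_equilibrium⟩

theorem theorem1 :
    (∀ (A : Type*) [Fintype A] (u : A → A → ℝ), (∀ i j, 0 ≤ u i j) →
      ArrowDebreu.IsConvexProgram u ∧
      ((ArrowDebreu.feasibleSet u).Nonempty ↔ ArrowDebreu.SingletonComponentsHaveLoops u) ∧
      (ArrowDebreu.SingletonComponentsHaveLoops u →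
        IsLeast (ArrowDebreu.objective u '' ArrowDebreu.feasibleSet u) 0 ∧
        ∀ z : ArrowDebreu.Vars A, ArrowDebreu.IsOptimal u z →
          ArrowDebreu.IsEquilibrium u z.price (fun i j => z.pay i j / z.price j))) ∧
    (∃ P : Polynomial ℕ, ∀ (A : Type*) [Fintype A] (u : A → A → ℚ), (∀ i j, 0 ≤ u i j) →
      ArrowDebreu.SingletonComponentsHaveLoops (fun i j => (u i j : ℝ)) →
      ∃ (y : A → A → ℚ) (p β : A → ℚ),
        ((fun i j => (y i j : ℝ), fun i => (p i : ℝ), fun i => (β i : ℝ)) : ArrowDebreu.Vars A) ∈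
          (ArrowDebreu.feasibleSet (fun i j => (u i j : ℝ))).extremePoints ℝ ∧
        ArrowDebreu.IsOptimal (fun i j => (u i j : ℝ))
          (fun i j => (y i j : ℝ), fun i => (p i : ℝ), fun i => (β i : ℝ)) ∧
        ArrowDebreu.IsEquilibrium (fun i j => (u i j : ℝ)) (fun i => (p i : ℝ))
          (fun i j => ((y i j / p j : ℚ) : ℝ)) ∧
        ArrowDebreu.outputSize p (fun i j => y i j / p j) ≤ P.eval (ArrowDebreu.inputSize u)) :=
  theorem1_general.imp (fun h A _ u _ => h A u) fun ⟨P, hP⟩ => ⟨P, fun A _ u _ => hP A u⟩
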